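/- **Notation.** Fix $r\in\mathbb N$. Strings are pairs $(\rho,\sigma)$ with $\rho\in 3^{<\mathbb N}$ and $\sigma=(\sigma_0,\dots,\sigma_{r-1})\in(2^{<\mathbb N})^r$, ordered by the componentwise prefix relation $\preccurlyeq$. Call $(\rho,\sigma)$ *balanced* if all $\sigma_s$ have the same length and this length is at most $|\rho|$. A *cross-tree* is a set $T$ of balanced strings such that every balanced string $\preccurlyeq$ an element of $T$ is in $T$. Its class of paths $[T]$ is the set of all $(X,Y)\in 3^{\mathbb N}\times(2^{\mathbb N})^r$ with $(X{\upharpoonright}_n,Y{\upharpoonright}_n)\in T$ for every $n$. $T$ is *left-full* if for every $X\in 3^{\mathbb N}$ there is $Y\in(2^{\mathbb N})^r$ with $(X,Y)\in[T]$. Two functions $f,g:\mathbb N\to k$ are *finitely compatible* if for every $i<k$ the set $\{n: f(n)=g(n)=i\}$ is finite, and *infinitely compatible* otherwise. The instances of the *cross-constraint problem* $\mathsf{CC}$ are the left-full cross-trees $T$; a solution to $T$ is a pair of paths $(X^0,Y^0),(X^1,Y^1)\in[T]$ such that $(X^0,X^1)$ is finitely compatible and, for every $s<r$, $(Y^0_s,Y^1_s)$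 is infinitely compatible. A *Turing ideal* is a nonempty class of subsets of $\mathbb N$ that is closed downward under Turing reducibility $\le_T$ and closed under the join $\oplus$. A *cross-constraint ideal* is a Turing ideal $\mathcal M$ such that every instance $T\in\mathcal M$ of $\mathsf{CC}$ has a solution with $(X^0,Y^0)\oplus(X^1,Y^1)\in\mathcal M$. (Finite objects are identified with their codes in $\mathbb N$, and a path $(X,Y)$ with the graph of $n\mapsto (X(n),Y_0(n),\dots,Y_{r-1}(n))$, coded as a subset of $\mathbb N$.) **Theorem.** For every $r\in\mathbb N$: 1. Let $C\subseteq\mathbb N$ be a non-$\Sigma^0_1$ set. Every computable instance $T$ of $\mathsf{CC}$ has a solution $(X^0,Y^0),(X^1,Y^1)$ such that $C$ is not $\Sigma^0_1$ relative to $(X^0,Y^0)\oplus(X^1,Y^1)$. 2. For every non-$\Sigma^0_1$ set $C\subseteq\mathbb N$ there is a cross-constraint ideal $\mathcal M$ such that $C$ is not $\Sigma^0_1$ relative to any element of $\mathcal M$. 3. Let $C\subseteq\mathbb N$ be a non-computable set. Every computable instance $T$ of $\mathsf{CC}$ has a solution $(X^0,Y^0),(X^1,Y^1)$ such that $C\not\le_T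 (X^0,Y^0)\oplus(X^1,Y^1)$. -/

import Mathlib

/-- The characteristic function of a set of natural numbers, as an oracle. -/
noncomputable def charFun (A : Set ℕ) : ℕ →. ℕ :=
  open Classical in fun n => Part.some (if n ∈ A then 1 else 0)

/-- `A` is Turing reducible to `B`. -/
def SetTuringLE (A B : Set ℕ) : Prop :=
  TuringReducible (charFun A) (charFun B)

/-- The set `A` is computable. -/
def IsComputableSet {α : Type*} [Primcodable α] (A : Set α) : Prop :=
  ComputablePred fun a => a ∈ A

/-- `C` is `Σ⁰₁`, that is, computably enumerable. -/
def IsSigma01 (C : Set ℕ) : Prop :=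
  REPred fun n => n ∈ C

/-- `C` is `Σ⁰₁` relative to `Z`: it is the domain of a partial function that is
recursive in `Z`. -/
def IsSigma01In (Z C : Set ℕ) : Prop :=
  RecursiveIn {charFun Z} fun n : ℕ => Part.assert (n ∈ C) fun _ => Part.some ()

/-- The code of a finite object as a natural number. -/
def natCode {α : Type*} [Primcodable α] (a : α) : ℕ :=
  Encodable.encode a

/-- The join `A ⊕ B` of two sets of natural numbers. -/
def setJoin (A B : Set ℕ) : Set ℕ :=
  {m | (∃ n ∈ A, m = 2 * n) ∨ ∃ n ∈ B, m = 2 * n + 1}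

/-- Finite strings: one 3-valued string and an `r`-tuple of 2-valued strings. -/
abbrev CrossString (r : ℕ) : Type :=
  List (Fin 3) × (Fin r → List (Fin 2))

/-- The space `3^ℕ × (2^ℕ)^r`. -/
abbrev CrossPoint (r : ℕ) : Type :=
  (ℕ → Fin 3) × (Fin r → ℕ → Fin 2)

namespace CrossString

/-- The componentwise prefix relation. -/
def IsPrefix {r : ℕ} (χ ψ : CrossString r) : Prop :=
  χ.1 <+: ψ.1 ∧ ∀ s, χ.2 s <+: ψ.2 s

/-- The strings `(ρ, σ)` which may occur in a cross-tree: the components of `σ` have the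
same length, and this length is at most that of `ρ`. -/
def IsBalanced {r : ℕ} (χ : CrossString r) : Prop :=
  (∀ s t, (χ.2 s).length = (χ.2 t).length) ∧ ∀ s, (χ.2 s).length ≤ χ.1.length

end CrossString

/-- The string of the first `n` values of `f`. -/
def initSeg {k : ℕ} (f : ℕ → Fin k) (n : ℕ) : List (Fin k) :=
  (List.range n).map f

namespace CrossPoint

/-- `(X ↾ n, Y ↾ n)`. -/
def restrict {r : ℕ} (z : CrossPoint r) (n : ℕ) : CrossString r :=
  (initSeg z.1 n, fun s => initSeg (z.2 s) n)

/-- The point `(X, Y)` as a set of natural numbers: the graph of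
`n ↦ (X n, (Y_s n)_{s < r})`. -/
def toSet {r : ℕ} (z : CrossPoint r) : Set ℕ :=
  {m | ∃ n, m = Nat.pair n (natCode (z.1 n, fun s => z.2 s n))}

end CrossPoint

/-- A cross-tree: a set of balanced strings, closed under balanced prefixes. -/
def IsCrossTree {r : ℕ} (T : Set (CrossString r)) : Prop :=
  (∀ χ ∈ T, χ.IsBalanced) ∧
    ∀ χ ∈ T, ∀ ψ : CrossString r, ψ.IsBalanced → ψ.IsPrefix χ → ψ ∈ T

/-- The class `[T]` of infinite paths. -/
def paths {r : ℕ} (T : Set (CrossString r)) : Set (CrossPoint r) :=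
  {z | ∀ n, z.restrict n ∈ T}

/-- A class is left-full if every `X` is the left component of one of its members. -/
def LeftFull {r : ℕ} (P : Set (CrossPoint r)) : Prop :=
  ∀ X, ∃ Y, (X, Y) ∈ P

/-- Two colorings with `k` colors are finitely compatible if each color is taken by both
simultaneously only finitely often. -/
def FinitelyCompatible {k : ℕ} (f g : ℕ → Fin k) : Prop :=
  ∀ i, (f ⁻¹' {i} ∩ g ⁻¹' {i}).Finite

/-- Instances of the cross-constraint problem `CC`: left-full cross-trees. -/
def IsCCInstance {r : ℕ} (T : Set (CrossString r)) : Prop :=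
  IsCrossTree T ∧ LeftFull (paths T)

/-- `(z₀, z₁) = ((X⁰, Y⁰), (X¹, Y¹))` is a solution to the instance `T` of `CC`. -/
def IsCCSolution {r : ℕ} (T : Set (CrossString r)) (z₀ z₁ : CrossPoint r) : Prop :=
  z₀ ∈ paths T ∧ z₁ ∈ paths T ∧ FinitelyCompatible z₀.1 z₁.1 ∧
    ∀ s, ¬ FinitelyCompatible (z₀.2 s) (z₁.2 s)

/-- A Turing ideal: a nonempty class of sets closed under Turing reducibility and join. -/
def IsTuringIdeal (M : Set (Set ℕ)) : Prop :=
  M.Nonempty ∧ (∀ A ∈ M, ∀ B, SetTuringLE B A → B ∈ M) ∧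
    ∀ A ∈ M, ∀ B ∈ M, setJoin A B ∈ M

/-- A cross-constraint ideal (for `r`): a Turing ideal in which every instance of `CC` in the
ideal, coded as a set of natural numbers, has a solution in the ideal. -/
def IsCrossConstraintIdeal (r : ℕ) (M : Set (Set ℕ)) : Prop :=
  IsTuringIdeal M ∧
    ∀ T : Set (CrossString r), IsCCInstance T → natCode '' T ∈ M →
      ∃ z₀ z₁, IsCCSolution T z₀ z₁ ∧ setJoin z₀.toSet z₁.toSet ∈ M

/-! A solution is built by forcing with `Π⁰₁` classes. A condition is a finite stem for `X` together
with a class, closed relative to an oracle `Z`, that has a point over every admissible `X` extending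
the stem. Since the `Y`-coordinates range over a compact space, "all points of the class over `X`
satisfy a given open property" is open in `X` (`IsSigmaOn.forall_seq`). Hence the set of numbers
that some `X` in the cylinder forces into a given enumeration is `Σ⁰₁` in `Z` and differs from `C`.
At a difference, either shrinking the class or lengthening the stem spoils the enumeration
(`Condition.exists_le_avoid`). So a sufficiently generic point does not enumerate `C`, and it can
meet countably many further dense requirements (`Condition.exists_generic`).

The combinatorial task is to make the first components eventually different while every
`Y`-component agrees infinitely often. Components that can be frozen are frozen, at the price of a
stronger oracle that still does not enumerate `C` (`exists_forall_not_hasConst`); agreement there is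
automatic. For another component `s`, the obstacle is a pair of conditions in which every point of
the first can be opposed in `s` over all `X` of the second that avoid its first component
(`Opposes`). Two consecutive oppositions would freeze `s`: a third colour provides a sequence
avoiding two given ones, and two disagreements between bits are an agreement (`Opposes.hasConst`).
Hence opposition disappears below some condition (`exists_forall_not_opposes`).

Without opposition, a generic first point `z` has the property that every stem extends to some `X`,
avoiding the first component of `z` beyond the stem, over which all points agree with `z` in `s`
arbitrarily late (`exists_first_point`). The second point is then generic over `Z ⊕ z` among
sequences avoiding the first component of `z`; these `X` make late agreement dense
(`exists_second_point`).

Iterating the relativized result with bookkeeping gives the ideal, made of the sets `Δ⁰₁` in some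
oracle of the sequence. The statement on non-computable `C` follows since `C` or its complement is
not `Σ⁰₁`. -/

/-! ### `Σ⁰₁` predicates of an oracle, via finite initial segments. -/

/-- The list of the first `k` values of `x`. -/
def firstValues {Γ : Type} (x : ℕ → Γ) (k : ℕ) : List Γ :=
  (List.range k).map x

/-- The sequence of pairs of values of `f` and `g`. -/
def zipSeq {Γ Δ : Type} (f : ℕ → Γ) (g : ℕ → Δ) (n : ℕ) : Γ × Δ :=
  (f n, g n)

/-- On oracles from the set `D`, the predicate `P` is uniformly `Σ⁰₁` relative to the oracle:
it is witnessed by a primitive recursive monotone predicate of finite initial segments. -/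
def IsSigmaOn {α Γ : Type} [Primcodable α] [Primcodable Γ] (D : Set (ℕ → Γ))
    (P : α → (ℕ → Γ) → Prop) : Prop :=
  ∃ R : α × List Γ → Prop, PrimrecPred R ∧
    (∀ a L M, L <+: M → R (a, L) → R (a, M)) ∧
    ∀ a, ∀ x ∈ D, P a x ↔ ∃ k, R (a, firstValues x k)

section FirstValues

variable {Γ Δ : Type}

@[simp] lemma length_firstValues (x : ℕ → Γ) (k : ℕ) : (firstValues x k).length = k := by
  simp [firstValues]

lemma getElem?_firstValues (x : ℕ → Γ) {i k : ℕ} (h : i < k) :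
    (firstValues x k)[i]? = some (x i) := by
  simp [firstValues, h]

lemma firstValues_prefix (x : ℕ → Γ) {j k : ℕ} (h : j ≤ k) :
    firstValues x j <+: firstValues x k := by
  obtain ⟨d, rfl⟩ := Nat.exists_eq_add_of_le h
  refine ⟨(List.range d).map (fun i => x (j + i)), ?_⟩
  simp [firstValues, List.range_add, Function.comp_def]

lemma take_firstValues (x : ℕ → Γ) {j k : ℕ} (h : j ≤ k) :
    (firstValues x k).take j = firstValues x j := by
  have := List.prefix_iff_eq_take.1 (firstValues_prefix x h)
  simpa using this.symm

lemma firstValues_comp (φ : Γ → Δ) (x : ℕ → Γ) (k : ℕ) :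
    firstValues (φ ∘ x) k = (firstValues x k).map φ := by
  simp [firstValues]

lemma firstValues_congr {x y : ℕ → Γ} {k : ℕ} (h : ∀ i < k, x i = y i) :
    firstValues x k = firstValues y k :=
  List.map_congr_left fun i hi => h i (List.mem_range.1 hi)

lemma eq_firstValues_iff (L : List Γ) (x : ℕ → Γ) :
    L = firstValues x L.length ↔ ∀ i ∈ List.range L.length, L[i]? = some (x i) := by
  constructor
  · intro h i hi
    rw [h]
    exact getElem?_firstValues x (by simpa using hi)
  · intro h
    refine List.ext_getElem? fun i => ?_
    by_cases hi : i < L.length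
    · rw [h i (by simpa using hi), getElem?_firstValues x hi]
    · rw [List.getElem?_eq_none (by omega), List.getElem?_eq_none (by simp; omega)]

end FirstValues

namespace IsSigmaOn

variable {α β Γ Δ : Type} [Primcodable α] [Primcodable β] [Primcodable Γ] [Primcodable Δ]
  {D : Set (ℕ → Γ)} {P Q : α → (ℕ → Γ) → Prop}

lemma of_iff (h : IsSigmaOn D P) (e : ∀ a, ∀ x ∈ D, Q a x ↔ P a x) : IsSigmaOn D Q := by
  obtain ⟨R, hR, hm, hP⟩ := h
  exact ⟨R, hR, hm, fun a x hx => (e a x hx).trans (hP a x hx)⟩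

/-- Monotonicity of the witnessing predicate need not be checked. -/
lemma mk {R : α × List Γ → Prop} (hR : PrimrecPred R) :
    IsSigmaOn D (fun a x => ∃ k, R (a, firstValues x k)) := by
  refine ⟨fun p => ∃ j ∈ List.range (p.2.length + 1), R (p.1, p.2.take j), ?_, ?_, ?_⟩
  · have : PrimrecRel (fun (j : ℕ) (p : α × List Γ) => R (p.1, p.2.take j)) :=
      hR.comp (Primrec.pair (Primrec.fst.comp Primrec.snd)
        (Primrec.list_take.comp Primrec.fst (Primrec.snd.comp Primrec.snd)))
    exact this.exists_mem_list.comp (Primrec.list_range.comp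
      (Primrec.succ.comp (Primrec.list_length.comp Primrec.snd))) Primrec.id
  · rintro a L M ⟨N, rfl⟩ ⟨j, hj, h⟩
    refine ⟨j, ?_, ?_⟩
    · simp at hj ⊢; omega
    · have : j ≤ L.length := by simp at hj; omega
      simpa [List.take_append_of_le_length this] using h
  · intro a x _
    constructor
    · rintro ⟨k, hk⟩
      exact ⟨k, k, by simp, by simpa [take_firstValues x le_rfl] using hk⟩
    · rintro ⟨k, j, hj, h⟩
      have : j ≤ k := by simp at hj; omega
      exact ⟨j, by simpa [take_firstValues x this] using h⟩

lemma prim {p : α → Prop} (hp : PrimrecPred p) : IsSigmaOn D (fun a _ => p a) :=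
  ⟨fun q => p q.1, hp.comp Primrec.fst, fun _ _ _ _ h => h, fun _ _ _ => by simp⟩

lemma and (hP : IsSigmaOn D P) (hQ : IsSigmaOn D Q) : IsSigmaOn D (fun a x => P a x ∧ Q a x) := by
  obtain ⟨R, hR, hm, hP⟩ := hP
  obtain ⟨S, hS, hn, hQ⟩ := hQ
  refine ⟨fun p => R p ∧ S p, hR.and hS, fun a L M h k => ⟨hm a L M h k.1, hn a L M h k.2⟩, ?_⟩
  intro a x hx
  refine (and_congr (hP a x hx) (hQ a x hx)).trans ?_
  constructor
  · rintro ⟨⟨j, hj⟩, ⟨k, hk⟩⟩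
    exact ⟨max j k, hm _ _ _ (firstValues_prefix x (le_max_left _ _)) hj,
      hn _ _ _ (firstValues_prefix x (le_max_right _ _)) hk⟩
  · rintro ⟨k, h1, h2⟩
    exact ⟨⟨k, h1⟩, ⟨k, h2⟩⟩

lemma or (hP : IsSigmaOn D P) (hQ : IsSigmaOn D Q) : IsSigmaOn D (fun a x => P a x ∨ Q a x) := by
  obtain ⟨R, hR, hm, hP⟩ := hP
  obtain ⟨S, hS, hn, hQ⟩ := hQ
  refine ⟨fun p => R p ∨ S p, hR.or hS,
    fun a L M h k => k.imp (hm a L M h) (hn a L M h), ?_⟩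
  intro a x hx
  exact (or_congr (hP a x hx) (hQ a x hx)).trans exists_or.symm

lemma subst {P : β → (ℕ → Γ) → Prop} (hP : IsSigmaOn D P) {f : α → β} (hf : Primrec f) :
    IsSigmaOn D (fun a x => P (f a) x) := by
  obtain ⟨R, hR, hm, hP⟩ := hP
  exact ⟨fun p => R (f p.1, p.2), hR.comp ((hf.comp Primrec.fst).pair Primrec.snd),
    fun a L M h => hm _ L M h, fun a x hx => hP _ x hx⟩

/-- The length of the initial segment also bounds the code of the witness searched for, so one
bounded search suffices; monotonicity reconciles the two bounds. -/
lemma ex {P : α × β → (ℕ → Γ) → Prop} (hP : IsSigmaOn D P) :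
    IsSigmaOn D (fun a x => ∃ b, P (a, b) x) := by
  obtain ⟨R, hR, hm, hP⟩ := hP
  have hS : PrimrecPred (fun p : α × List Γ =>
      ∃ b ∈ (List.range (p.2.length + 1)).filterMap (fun i => (Encodable.decode i : Option β)),
        R ((p.1, b), p.2)) := by
    have : PrimrecRel (fun (b : β) (p : α × List Γ) => R ((p.1, b), p.2)) :=
      hR.comp (((Primrec.fst.comp Primrec.snd).pair Primrec.fst).pair
        (Primrec.snd.comp Primrec.snd))
    refine this.exists_mem_list.comp (Primrec.listFilterMap ?_ ?_) Primrec.id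
    · exact Primrec.list_range.comp (Primrec.succ.comp (Primrec.list_length.comp Primrec.snd))
    · exact Primrec.decode.comp Primrec.snd
  refine (mk hS).of_iff fun a x hx => ?_
  constructor
  · rintro ⟨b, hb⟩
    obtain ⟨k, hk⟩ := (hP _ x hx).1 hb
    refine ⟨max k (Encodable.encode b), b, ?_, hm _ _ _ (firstValues_prefix x (le_max_left _ _)) hk⟩
    simp only [List.mem_filterMap, List.mem_range, length_firstValues]
    exact ⟨Encodable.encode b, by omega, Encodable.encodek b⟩
  · rintro ⟨k, b, -, hb⟩
    exact ⟨b, (hP _ x hx).2 ⟨k, hb⟩⟩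

lemma all {P : α × β → (ℕ → Γ) → Prop} (hP : IsSigmaOn D P) {l : α → List β} (hl : Primrec l) :
    IsSigmaOn D (fun a x => ∀ b ∈ l a, P (a, b) x) := by
  obtain ⟨R, hR, hm, hP⟩ := hP
  refine ⟨fun p => ∀ b ∈ l p.1, R ((p.1, b), p.2), ?_, ?_, ?_⟩
  · have : PrimrecRel (fun (b : β) (p : α × List Γ) => R ((p.1, b), p.2)) :=
      hR.comp (((Primrec.fst.comp Primrec.snd).pair Primrec.fst).pair
        (Primrec.snd.comp Primrec.snd))
    exact this.forall_mem_list.comp (hl.comp Primrec.fst) Primrec.id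
  · exact fun a L M h H b hb => hm _ L M h (H b hb)
  · intro a x hx
    constructor
    · intro H
      have key : ∀ t : List β, (∀ b ∈ t, P (a, b) x) →
          ∃ k, ∀ b ∈ t, R ((a, b), firstValues x k) := by
        intro t
        induction t with
        | nil => intro _; exact ⟨0, by simp⟩
        | cons c t ih =>
          intro h
          obtain ⟨k, hk⟩ := ih fun b hb => h b (List.mem_cons_of_mem _ hb)
          obtain ⟨j, hj⟩ := (hP _ x hx).1 (h c List.mem_cons_self)
          refine ⟨max j k, fun b hb => ?_⟩
          rcases List.mem_cons.1 hb with rfl | hb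
          · exact hm _ _ _ (firstValues_prefix x (le_max_left _ _)) hj
          · exact hm _ _ _ (firstValues_prefix x (le_max_right _ _)) (hk b hb)
      exact key _ H
    · rintro ⟨k, hk⟩ b hb
      exact (hP _ x hx).2 ⟨k, hk b hb⟩

lemma oracle : IsSigmaOn D (fun (p : ℕ × Γ) x => x p.1 = p.2) := by
  have : PrimrecPred (fun p : (ℕ × Γ) × List Γ => p.2[p.1.1]? = some p.1.2) :=
    Primrec.eq.comp (Primrec.list_getElem?.comp Primrec.snd (Primrec.fst.comp Primrec.fst))
      (Primrec.option_some.comp (Primrec.snd.comp Primrec.fst))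
  refine (mk this).of_iff fun p x _ => ?_
  constructor
  · intro h
    exact ⟨p.1 + 1, by rw [← h]; exact getElem?_firstValues x (Nat.lt_succ_self _)⟩
  · rintro ⟨k, hk⟩
    by_cases h : p.1 < k
    · rw [getElem?_firstValues x h] at hk
      exact Option.some_injective _ hk
    · rw [List.getElem?_eq_none (by simpa using h)] at hk
      simp at hk

lemma value {S : Γ → Prop} (hS : PrimrecPred S) : IsSigmaOn D (fun (n : ℕ) x => S (x n)) := by
  have h : IsSigmaOn D (fun (n : ℕ) x => ∃ c : Γ, x n = c ∧ S c) :=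
    ex (P := fun p x => x p.1 = p.2 ∧ S p.2) (oracle.and (prim (hS.comp Primrec.snd)))
  exact h.of_iff fun n x _ => by simp

/-- Transitivity: the oracle may be replaced by a function computed from the oracle. -/
lemma trans {D' : Set (ℕ → Δ)} {P : α → (ℕ → Δ) → Prop} (hP : IsSigmaOn D' P)
    {G : (ℕ → Γ) → (ℕ → Δ)} (hG : IsSigmaOn D (fun (p : ℕ × Δ) x => G x p.1 = p.2))
    (hD : ∀ x ∈ D, G x ∈ D') : IsSigmaOn D (fun a x => P a (G x)) := by
  obtain ⟨R, hR, hm, hP⟩ := hP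
  -- The oracle `G x` is read through a guessed list, verified entry by entry; a verified list is an
  -- initial segment of `G x`.
  have h1 : IsSigmaOn D (fun (q : (α × List Δ) × ℕ) x =>
      ∃ c, G x q.2 = c ∧ q.1.2[q.2]? = some c) := by
    refine ex (P := fun (q : ((α × List Δ) × ℕ) × Δ) x => G x q.1.2 = q.2 ∧
      q.1.1.2[q.1.2]? = some q.2) (IsSigmaOn.and ?_ (prim ?_))
    · exact hG.subst (f := fun q : ((α × List Δ) × ℕ) × Δ => (q.1.2, q.2))
        ((Primrec.snd.comp Primrec.fst).pair Primrec.snd)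
    · exact Primrec.eq.comp (Primrec.list_getElem?.comp
        (Primrec.snd.comp (Primrec.fst.comp Primrec.fst)) (Primrec.snd.comp Primrec.fst))
        (Primrec.option_some.comp Primrec.snd)
  have h2 := h1.all (l := fun q => List.range q.2.length)
    (Primrec.list_range.comp (Primrec.list_length.comp Primrec.snd))
  refine ((prim (D := D) hR).and h2).ex.of_iff fun a x hx => ?_
  rw [hP a _ (hD x hx)]
  have e : ∀ L : List Δ, (∀ b ∈ List.range L.length, ∃ c, G x b = c ∧ L[b]? = some c) ↔
      L = firstValues (G x) L.length := by
    intro L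
    rw [eq_firstValues_iff]
    simp
  simp only [e]
  constructor
  · rintro ⟨k, hk⟩
    exact ⟨_, hk, by simp⟩
  · rintro ⟨L, hL, h⟩
    exact ⟨L.length, h ▸ hL⟩

lemma map {D' : Set (ℕ → Δ)} {P : α → (ℕ → Δ) → Prop} (hP : IsSigmaOn D' P)
    {φ : Γ → Δ} (hφ : Primrec φ) (hD : ∀ x ∈ D, φ ∘ x ∈ D') :
    IsSigmaOn D (fun a x => P a (φ ∘ x)) := by
  refine hP.trans (G := fun x => φ ∘ x) ?_ hD
  have h : IsSigmaOn D (fun (p : ℕ × Δ) x => ∃ c : Γ, x p.1 = c ∧ φ c = p.2) := by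
    refine ex (P := fun (q : (ℕ × Δ) × Γ) x => x q.1.1 = q.2 ∧ φ q.2 = q.1.2)
      (IsSigmaOn.and ?_ (prim ?_))
    · exact oracle.subst (f := fun q : (ℕ × Δ) × Γ => (q.1.1, q.2))
        ((Primrec.fst.comp Primrec.fst).pair Primrec.snd)
    · exact Primrec.eq.comp (hφ.comp Primrec.snd) (Primrec.snd.comp Primrec.fst)
  exact h.of_iff fun p x _ => by simp

/-- A predicate `P a x` that holds at `x` holds at all oracles sharing an initial segment. -/
lemma exists_agree (hP : IsSigmaOn D P) {a : α} {x : ℕ → Γ} (hx : x ∈ D) (h : P a x) :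
    ∃ k, ∀ y ∈ D, (∀ i < k, y i = x i) → P a y := by
  obtain ⟨R, -, -, hP⟩ := hP
  obtain ⟨k, hk⟩ := (hP a x hx).1 h
  exact ⟨k, fun y hy hxy => (hP a y hy).2 ⟨k, by rwa [firstValues_congr hxy]⟩⟩

/-- The step bound in `evaln` serves as the existential witness; the oracle is ignored. -/
lemma of_re {p : α → Prop} (hp : REPred p) : IsSigmaOn D (fun a _ => p a) := by
  obtain ⟨c, hc⟩ := Nat.Partrec.Code.exists_code.1 hp
  have h : PrimrecPred (fun q : α × ℕ =>
      (Nat.Partrec.Code.evaln q.2 c (Encodable.encode q.1)).isSome = true) := by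
    refine Primrec.eq.comp (Primrec.option_isSome.comp ?_) (Primrec.const true)
    exact Nat.Partrec.Code.primrec_evaln.comp
      ((Primrec.snd.pair (Primrec.const c)).pair (Primrec.encode.comp Primrec.fst))
  refine (prim (D := D) h).ex.of_iff fun a x _ => ?_
  have e : (c.eval (Encodable.encode a)).Dom ↔ p a := by
    rw [hc]
    simp [Part.assert]
  rw [← e, Part.dom_iff_mem]
  simp only [Nat.Partrec.Code.evaln_complete, Option.isSome_iff_exists, Option.mem_def]
  exact exists_comm

end IsSigmaOn

/-! ### Compactness and quantification over sequences. -/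

/-- A set of sequences containing every limit of its members. -/
def IsLimitClosed {β : Type} (F : Set (ℕ → β)) : Prop :=
  ∀ y, (∀ k, ∃ z ∈ F, ∀ i < k, z i = y i) → y ∈ F

/-- Compactness of the space of sequences over a finite alphabet. -/
lemma exists_forall_mem_of_isLimitClosed {β : Type} [Finite β] (F : ℕ → Set (ℕ → β))
    (hF : ∀ k, IsLimitClosed (F k)) (hmono : ∀ k, F (k + 1) ⊆ F k) (hne : ∀ k, (F k).Nonempty) :
    ∃ y, ∀ k, y ∈ F k := by
  let _ : TopologicalSpace β := ⊥
  have : DiscreteTopology β := ⟨rfl⟩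
  have nhd : ∀ (y : ℕ → β) (k : ℕ), {z : ℕ → β | ∀ i < k, z i = y i} ∈ nhds y := by
    intro y k
    have : {z : ℕ → β | ∀ i < k, z i = y i} = Set.pi (Set.Iio k) fun i => {y i} := by
      ext z; simp [Set.mem_pi]
    rw [this]
    exact set_pi_mem_nhds (Set.finite_Iio k) fun i _ => (isOpen_discrete _).mem_nhds rfl
  have cl : ∀ k, IsClosed (F k) := by
    intro k
    rw [← isOpen_compl_iff, isOpen_iff_mem_nhds]
    intro y hy
    have : ∃ j, ∀ z ∈ F k, ¬ ∀ i < j, z i = y i := by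
      by_contra hc
      push Not at hc
      exact hy (hF k y hc)
    obtain ⟨j, hj⟩ := this
    filter_upwards [nhd y j] with z hz hzS using hj z hzS hz
  obtain ⟨y, hy⟩ := IsCompact.nonempty_iInter_of_sequence_nonempty_isCompact_isClosed
    F hmono hne (cl 0).isCompact cl
  exact ⟨y, by simpa using hy⟩

/-- If each sequence over a finite alphabet has an initial segment satisfying a monotone
condition, then some length works for all sequences. -/
lemma exists_uniform_length {β : Type} [Finite β] (q : ℕ → (ℕ → β) → Prop)
    (hq : ∀ k y, q k y → q (k + 1) y)
    (hloc : ∀ k y z, (∀ i < k, y i = z i) → q k y → q k z)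
    (h : ∀ y, ∃ k, q k y) : ∃ k, ∀ y, q k y := by
  by_contra hc
  push Not at hc
  obtain ⟨y, hy⟩ := exists_forall_mem_of_isLimitClosed (fun k => {y | ¬ q k y})
    (fun k y H hy => by
      obtain ⟨z, hz, hzy⟩ := H k
      exact hz (hloc k y z (fun i hi => (hzy i hi).symm) hy))
    (fun k y hy hk => hy (hq k y hk)) hc
  obtain ⟨k, hk⟩ := h y
  exact hy k hk

section Extensions

variable {Γ β : Type}

/-- All lists of pairs whose first components form the given list and whose second
components are taken from `us`. -/
def pairExtensions (us : List β) (L : List Γ) : List (List (Γ × β)) :=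
  L.foldr (fun c acc => us.flatMap fun b => acc.map ((c, b) :: ·)) [[]]

lemma mem_pairExtensions {us : List β} (hus : ∀ b, b ∈ us) (L : List Γ) (M : List (Γ × β)) :
    M ∈ pairExtensions us L ↔ M.map Prod.fst = L := by
  induction L generalizing M with
  | nil => simp [pairExtensions]
  | cons c L ih =>
    have : pairExtensions us (c :: L) =
        us.flatMap fun b => (pairExtensions us L).map ((c, b) :: ·) := rfl
    rw [this]
    simp only [List.mem_flatMap, List.mem_map, ih]
    constructor
    · rintro ⟨b, -, N, rfl, rfl⟩
      rfl
    · intro h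
      cases M with
      | nil => simp at h
      | cons p M =>
        simp only [List.map_cons, List.cons.injEq] at h
        exact ⟨p.2, hus _, M, h.2, by rw [← h.1]⟩

lemma primrec_pairExtensions [Primcodable Γ] [Primcodable β] (us : List β) :
    Primrec (pairExtensions us : List Γ → _) := by
  have h1 : Primrec₂ (fun (q : (List Γ × (Γ × List (List (Γ × β)))) × β) (M : List (Γ × β)) =>
      (q.1.2.1, q.2) :: M) :=
    Primrec.list_cons.comp ((Primrec.fst.comp (Primrec.snd.comp (Primrec.fst.comp
      Primrec.fst))).pair (Primrec.snd.comp Primrec.fst)) Primrec.snd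
  have h2 : Primrec₂ (fun (q : List Γ × (Γ × List (List (Γ × β)))) (b : β) =>
      q.2.2.map ((q.2.1, b) :: ·)) :=
    Primrec.list_map (Primrec.snd.comp (Primrec.snd.comp Primrec.fst)) h1
  exact Primrec.list_foldr Primrec.id (Primrec.const [[]])
    (Primrec.list_flatMap (Primrec.const us) h2).to₂

lemma map_fst_firstValues_zipSeq (x : ℕ → Γ) (Y : ℕ → β) (k : ℕ) :
    (firstValues (zipSeq x Y) k).map Prod.fst = firstValues x k := by
  rw [← firstValues_comp]; rfl

/-- A list extending an initial segment of `x` is an initial segment of some `(x, Y)`. -/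
lemma exists_eq_firstValues_zipSeq [Nonempty β] {x : ℕ → Γ} {k : ℕ} {M : List (Γ × β)}
    (h : M.map Prod.fst = firstValues x k) : ∃ Y, M = firstValues (zipSeq x Y) k := by
  have hl : M.length = k := by simpa using congrArg List.length h
  refine ⟨fun i => (M[i]?.map Prod.snd).getD (Classical.arbitrary β), ?_⟩
  have e : M = firstValues (zipSeq x fun i => (M[i]?.map Prod.snd).getD (Classical.arbitrary β))
      M.length := by
    rw [eq_firstValues_iff]
    intro i hi
    have hi : i < M.length := by simpa using hi
    have h2 : (M.map Prod.fst)[i]? = some (x i) := by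
      rw [h, getElem?_firstValues x (hl ▸ hi)]
    rw [List.getElem?_map, List.getElem?_eq_getElem hi] at h2
    simp only [Option.map_some, Option.some.injEq] at h2
    simp [zipSeq, List.getElem?_eq_getElem hi, ← h2]
  rwa [hl] at e

end Extensions

namespace IsSigmaOn

variable {α β Γ : Type} [Primcodable α] [Primcodable β] [Primcodable Γ]
  {D : Set (ℕ → Γ)} {D' : Set (ℕ → Γ × β)} {P : α → (ℕ → Γ × β) → Prop}

/-- `Σ⁰₁` predicates are closed under universal quantification over a compact space. -/
lemma forall_seq [Finite β] [Nonempty β] (hP : IsSigmaOn D' P)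
    (hD : ∀ x ∈ D, ∀ Y, zipSeq x Y ∈ D') :
    IsSigmaOn D (fun a x => ∀ Y : ℕ → β, P a (zipSeq x Y)) := by
  obtain ⟨R, hR, hm, hP⟩ := hP
  obtain ⟨us, hus⟩ : ∃ us : List β, ∀ b, b ∈ us := by
    have := Fintype.ofFinite β
    exact ⟨Finset.univ.toList, by simp⟩
  -- A segment of `x` has finitely many lifts to segments of pairs, so all can be tested;
  -- compactness supplies a length that works for all `Y` at once.
  refine ⟨fun p => ∀ M ∈ pairExtensions us p.2, R (p.1, M), ?_, ?_, ?_⟩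
  · have : PrimrecRel (fun (M : List (Γ × β)) (p : α × List Γ) => R (p.1, M)) :=
      hR.comp ((Primrec.fst.comp Primrec.snd).pair Primrec.fst)
    exact this.forall_mem_list.comp ((primrec_pairExtensions us).comp Primrec.snd) Primrec.id
  · intro a L L' hL H M hM
    rw [mem_pairExtensions hus] at hM
    refine hm a (M.take L.length) M (List.take_prefix _ _) (H _ ?_)
    rw [mem_pairExtensions hus, List.map_take, hM]
    exact (List.prefix_iff_eq_take.1 hL).symm
  · intro a x hx
    have hP' : ∀ Y, P a (zipSeq x Y) ↔ ∃ k, R (a, firstValues (zipSeq x Y) k) :=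
      fun Y => hP a _ (hD x hx Y)
    simp only [hP', mem_pairExtensions hus]
    constructor
    · intro H
      obtain ⟨k, hk⟩ := exists_uniform_length
        (fun k Y => R (a, firstValues (zipSeq x Y) k))
        (fun k Y => hm _ _ _ (firstValues_prefix _ (Nat.le_succ k)))
        (fun k Y Z h hY => by
          rwa [← firstValues_congr (x := zipSeq x Y) fun i hi => by simp [zipSeq, h i hi]]) H
      refine ⟨k, fun M hM => ?_⟩
      obtain ⟨Y, rfl⟩ := exists_eq_firstValues_zipSeq hM
      exact hk Y
    · rintro ⟨k, hk⟩ Y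
      exact ⟨k, hk _ (map_fst_firstValues_zipSeq x Y k)⟩

/-- `Σ⁰₁` predicates are closed under existential quantification over a product of nonempty
`Σ⁰₁` sets. -/
lemma exists_seq (hP : IsSigmaOn D' P) (hD : ∀ x ∈ D, ∀ Y, zipSeq x Y ∈ D')
    {K : ℕ × β → (ℕ → Γ) → Prop} (hK : IsSigmaOn D K) (hne : ∀ x ∈ D, ∀ i, ∃ b, K (i, b) x) :
    IsSigmaOn D (fun a x => ∃ Y : ℕ → β, (∀ i, K (i, Y i) x) ∧ P a (zipSeq x Y)) := by
  obtain ⟨R, hR, hm, hP⟩ := hP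
  have h1 : IsSigmaOn D (fun (q : (α × List (Γ × β)) × ℕ) x =>
      ∃ p : Γ × β, (x q.2 = p.1 ∧ K (q.2, p.2) x) ∧ q.1.2[q.2]? = some p) := by
    refine ex (P := fun (q : ((α × List (Γ × β)) × ℕ) × (Γ × β)) x =>
      (x q.1.2 = q.2.1 ∧ K (q.1.2, q.2.2) x) ∧ q.1.1.2[q.1.2]? = some q.2)
      (IsSigmaOn.and (IsSigmaOn.and ?_ ?_) (prim ?_))
    · exact oracle.subst (f := fun q : ((α × List (Γ × β)) × ℕ) × (Γ × β) => (q.1.2, q.2.1))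
        ((Primrec.snd.comp Primrec.fst).pair (Primrec.fst.comp Primrec.snd))
    · exact hK.subst (f := fun q : ((α × List (Γ × β)) × ℕ) × (Γ × β) => (q.1.2, q.2.2))
        ((Primrec.snd.comp Primrec.fst).pair (Primrec.snd.comp Primrec.snd))
    · exact Primrec.eq.comp (Primrec.list_getElem?.comp
        (Primrec.snd.comp (Primrec.fst.comp Primrec.fst)) (Primrec.snd.comp Primrec.fst))
        (Primrec.option_some.comp Primrec.snd)
  have h2 := h1.all (l := fun q => List.range q.2.length)
    (Primrec.list_range.comp (Primrec.list_length.comp Primrec.snd))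
  refine ((prim (D := D) hR).and h2).ex.of_iff fun a x hx => ?_
  constructor
  · rintro ⟨Y, hY, h⟩
    obtain ⟨k, hk⟩ := (hP a _ (hD x hx Y)).1 h
    refine ⟨_, hk, fun i hi => ⟨zipSeq x Y i, ⟨rfl, hY i⟩, ?_⟩⟩
    exact getElem?_firstValues _ (by simpa using hi)
  · rintro ⟨M, hM, h⟩
    -- The verified list already guarantees `P`; beyond it, any values allowed by `K` complete `Y`.
    choose b hb using hne x hx
    refine ⟨fun i => (M[i]?.map Prod.snd).getD (b i), fun i => ?_, (hP a _ (hD x hx _)).2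
      ⟨M.length, ?_⟩⟩
    · by_cases hi : i < M.length
      · obtain ⟨p, hp, hMi⟩ := h i (by simpa using hi)
        simpa [hMi] using hp.2
      · simpa [List.getElem?_eq_none (not_lt.1 hi)] using hb i
    · convert hM
      refine ((eq_firstValues_iff _ _).2 fun i hi => ?_).symm
      obtain ⟨p, hp, hMi⟩ := h i hi
      have hMi : M[i]? = some p := hMi
      simp [zipSeq, hMi, hp.1]

end IsSigmaOn

/-! ### Predicates relative to a fixed oracle, possibly with a sequence as parameter. -/

/-- A code computing the characteristic function determines the predicate. This makes the
requirements of the forcing countable. -/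
instance countable_primrecPred {α : Type} [Primcodable α] :
    Countable {R : α → Prop // PrimrecPred R} := by
  classical
  have h : ∀ R : {R : α → Prop // PrimrecPred R}, ∃ c : Nat.Partrec.Code,
      ∀ a, c.eval (Encodable.encode a) = Part.some (Encodable.encode (decide (R.1 a))) := by
    intro R
    obtain ⟨c, hc⟩ := Nat.Partrec.Code.exists_code.1 (R.2.decide.to_comp)
    exact ⟨c, fun a => by simp [hc]⟩
  choose c hc using h
  refine Function.Injective.countable (f := c) fun R S hRS => Subtype.ext (funext fun a => ?_)
  have h1 := hc R a
  rw [hRS, hc S a] at h1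
  simpa using (Part.some_injective h1).symm

/-- The predicate `p` is `Σ⁰₁` relative to `Z`. -/
def IsSigmaIn {α : Type} [Primcodable α] (Z : ℕ → ℕ) (p : α → Prop) : Prop :=
  IsSigmaOn {Z} fun a _ => p a

/-- The predicate `P a z` of a finite object `a` and a sequence `z` is `Σ⁰₁` relative to `Z`. -/
def IsSigmaRel {α Γ : Type} [Primcodable α] [Primcodable Γ] (Z : ℕ → ℕ)
    (P : α → (ℕ → Γ) → Prop) : Prop :=
  IsSigmaOn {w : ℕ → ℕ × Γ | Prod.fst ∘ w = Z} fun a w => P a (Prod.snd ∘ w)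

/-- The join of an oracle and a sequence, as an oracle. -/
def joinSeq {Γ : Type} [Primcodable Γ] (Z : ℕ → ℕ) (z : ℕ → Γ) (n : ℕ) : ℕ :=
  Nat.pair (Z n) (Encodable.encode (z n))

lemma eq_zipSeq {Γ Δ : Type} {w : ℕ → Γ × Δ} {Z : ℕ → Γ} (hw : Prod.fst ∘ w = Z) :
    w = zipSeq Z (Prod.snd ∘ w) := by
  subst hw; rfl

section Join

variable {α Γ : Type} [Primcodable α] [Primcodable Γ] {Z : ℕ → ℕ} {z : ℕ → Γ}

lemma primrec_pair_encode : Primrec (fun p : ℕ × Γ => Nat.pair p.1 (Encodable.encode p.2)) :=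
  Primrec₂.natPair.comp Primrec.fst (Primrec.encode.comp Primrec.snd)

lemma isSigmaIn_joinSeq {p : α → Prop} :
    IsSigmaIn (joinSeq Z z) p → IsSigmaOn {zipSeq Z z} fun a (_ : ℕ → ℕ × Γ) => p a :=
  fun h => IsSigmaOn.map (φ := fun p : ℕ × Γ => Nat.pair p.1 (Encodable.encode p.2)) h
    primrec_pair_encode (by rintro _ rfl; rfl)

lemma joinSeq_fst : (fun m : ℕ => m.unpair.1) ∘ joinSeq Z z = Z := by
  ext n; simp [joinSeq]

lemma IsSigmaIn.joinSeq {p : α → Prop} (h : IsSigmaIn Z p) : IsSigmaIn (joinSeq Z z) p :=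
  IsSigmaOn.map (φ := fun m : ℕ => m.unpair.1) h (Primrec.fst.comp Primrec.unpair)
    (by rintro _ rfl; exact joinSeq_fst)

lemma isSigmaIn_joinSeq_self [Inhabited Γ] :
    IsSigmaIn (_root_.joinSeq Z z) (fun p : ℕ × Γ => z p.1 = p.2) := by
  have h := IsSigmaOn.map (D := {_root_.joinSeq Z z}) (D' := Set.univ)
    -- The default is never reached, since the second coordinate always codes a value of `z`.
    (φ := fun m : ℕ => ((Encodable.decode m.unpair.2 : Option Γ)).getD default)
    (IsSigmaOn.oracle (Γ := Γ)) (Primrec.option_getD.comp (Primrec.decode.comp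
      (Primrec.snd.comp Primrec.unpair)) (Primrec.const default)) (fun _ _ => trivial)
  refine h.of_iff ?_
  rintro ⟨n, c⟩ _ rfl
  simp [_root_.joinSeq]

end Join

namespace IsSigmaRel

variable {α β Γ Δ : Type} [Primcodable α] [Primcodable β] [Primcodable Γ] [Primcodable Δ]
  {Z : ℕ → ℕ} {P Q : α → (ℕ → Γ) → Prop}

lemma of_iff (h : IsSigmaRel Z P) (e : ∀ a z, Q a z ↔ P a z) : IsSigmaRel Z Q :=
  IsSigmaOn.of_iff h fun a _ _ => e a _

lemma and (hP : IsSigmaRel Z P) (hQ : IsSigmaRel Z Q) :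
    IsSigmaRel Z (fun a z => P a z ∧ Q a z) :=
  IsSigmaOn.and hP hQ

lemma or (hP : IsSigmaRel Z P) (hQ : IsSigmaRel Z Q) :
    IsSigmaRel Z (fun a z => P a z ∨ Q a z) :=
  IsSigmaOn.or hP hQ

lemma prim {p : α → Prop} (hp : PrimrecPred p) :
    IsSigmaRel Z (fun a (_ : ℕ → Γ) => p a) :=
  IsSigmaOn.prim hp

lemma ex {P : α × β → (ℕ → Γ) → Prop} (hP : IsSigmaRel Z P) :
    IsSigmaRel Z (fun a z => ∃ b, P (a, b) z) :=
  IsSigmaOn.ex (P := fun q w => P q (Prod.snd ∘ w)) hP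

lemma subst {P : β → (ℕ → Γ) → Prop} (hP : IsSigmaRel Z P) {f : α → β} (hf : Primrec f) :
    IsSigmaRel Z (fun a z => P (f a) z) :=
  IsSigmaOn.subst hP hf

lemma of_isSigmaIn {p : α → Prop} (h : IsSigmaIn Z p) :
    IsSigmaRel Z (fun a (_ : ℕ → Γ) => p a) :=
  IsSigmaOn.map h Primrec.fst (fun _ hx => hx)

lemma value {S : Γ → Prop} (hS : PrimrecPred S) :
    IsSigmaRel Z (fun (n : ℕ) z => S (z n)) :=
  IsSigmaOn.value (S := fun c : ℕ × Γ => S c.2) (hS.comp Primrec.snd)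

lemma oracle : IsSigmaRel Z (fun (p : ℕ × Γ) z => z p.1 = p.2) :=
  IsSigmaOn.map (D' := Set.univ) IsSigmaOn.oracle Primrec.snd (fun _ _ => trivial)

lemma map {P : α → (ℕ → Δ) → Prop} (hP : IsSigmaRel Z P) {φ : Γ → Δ} (hφ : Primrec φ) :
    IsSigmaRel Z (fun a z => P a (φ ∘ z)) :=
  IsSigmaOn.map (φ := fun p : ℕ × Γ => (p.1, φ p.2)) hP
    (Primrec.fst.pair (hφ.comp Primrec.snd)) (fun _ hw => hw)

/-- There is `m ≥ n` such that the `m`-th entry has a decidable property. -/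
lemma exists_value {S : Γ → Prop} (hS : PrimrecPred S) (n : ℕ) :
    IsSigmaRel Z (fun (_ : α) z => ∃ m ≥ n, S (z m)) := by
  refine ex (P := fun (p : α × ℕ) z => p.2 ≥ n ∧ S (z p.2)) (and (prim ?_) ?_)
  · exact Primrec.nat_le.comp (Primrec.const n) Primrec.snd
  · exact (value hS).subst Primrec.snd

lemma forall_seq [Finite β] [Nonempty β] {P : α → (ℕ → Γ × β) → Prop} (hP : IsSigmaRel Z P) :
    IsSigmaRel Z (fun a z => ∀ Y : ℕ → β, P a (zipSeq z Y)) :=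
  IsSigmaOn.forall_seq (P := fun a (v : ℕ → (ℕ × Γ) × β) =>
      P a (Prod.snd ∘ (fun q : (ℕ × Γ) × β => (q.1.1, (q.1.2, q.2))) ∘ v))
    (IsSigmaOn.map hP ((Primrec.fst.comp Primrec.fst).pair
      ((Primrec.snd.comp Primrec.fst).pair Primrec.snd))
      (D := {v | Prod.fst ∘ Prod.fst ∘ v = Z}) (fun _ hx => hx))
    (fun _ hx _ => hx)

lemma exists_seq {P : α → (ℕ → Γ × β) → Prop} (hP : IsSigmaRel Z P)
    {K : ℕ × β → (ℕ → Γ) → Prop} (hK : IsSigmaRel Z K) (hne : ∀ z i, ∃ b, K (i, b) z) :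
    IsSigmaRel Z (fun a z => ∃ Y : ℕ → β, (∀ i, K (i, Y i) z) ∧ P a (zipSeq z Y)) :=
  IsSigmaOn.exists_seq (P := fun a (v : ℕ → (ℕ × Γ) × β) =>
      P a (Prod.snd ∘ (fun q : (ℕ × Γ) × β => (q.1.1, (q.1.2, q.2))) ∘ v))
    (IsSigmaOn.map hP ((Primrec.fst.comp Primrec.fst).pair
      ((Primrec.snd.comp Primrec.fst).pair Primrec.snd))
      (D := {v | Prod.fst ∘ Prod.fst ∘ v = Z}) (fun _ hx => hx))
    (fun _ hx _ => hx) hK (fun _ _ i => hne _ i)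

lemma exists_agree (hP : IsSigmaRel Z P) {a : α} {z : ℕ → Γ} (h : P a z) :
    ∃ k, ∀ y, (∀ i < k, y i = z i) → P a y := by
  obtain ⟨k, hk⟩ := IsSigmaOn.exists_agree hP (x := zipSeq Z z) rfl h
  exact ⟨k, fun y hy => hk (zipSeq Z y) rfl fun i hi => by simp [zipSeq, hy i hi]⟩

lemma joinSeq (hP : IsSigmaRel Z P) {z : ℕ → Δ} : IsSigmaRel (joinSeq Z z) P :=
  IsSigmaOn.map (φ := fun p : ℕ × Γ => (p.1.unpair.1, p.2)) hP
    ((Primrec.fst.comp (Primrec.unpair.comp Primrec.fst)).pair Primrec.snd)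
    (by
      intro w hw
      have : Prod.fst ∘ (fun p : ℕ × Γ => (p.1.unpair.1, p.2)) ∘ w =
        (fun m : ℕ => m.unpair.1) ∘ Prod.fst ∘ w := rfl
      have hw : Prod.fst ∘ w = _root_.joinSeq Z z := hw
      change _ = Z
      rw [this, hw, joinSeq_fst])

end IsSigmaRel

/-! ### `Π⁰₁` classes, forcing conditions and generic points. -/

/-- `𝒬` is a `Π⁰₁` class relative to `Z`. -/
def IsClosedIn {Γ : Type} [Primcodable Γ] (Z : ℕ → ℕ) (𝒬 : Set (ℕ → Γ)) : Prop :=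
  IsSigmaRel Z fun (_ : Unit) z => z ∉ 𝒬

lemma IsClosedIn.sep {Γ : Type} [Primcodable Γ] {Z : ℕ → ℕ} {𝒬 : Set (ℕ → Γ)}
    (h : IsClosedIn Z 𝒬) {P : (ℕ → Γ) → Prop} (hP : IsSigmaRel Z fun (_ : Unit) z => P z) :
    IsClosedIn Z {z ∈ 𝒬 | ¬ P z} :=
  (h.or hP).of_iff fun _ z => by
    simp only [Set.mem_sep_iff, not_and, not_not]
    exact imp_iff_not_or

/-- Exclusion from the class is decided by finitely many values, which a nearby member would share.
-/
lemma IsClosedIn.isLimitClosed {Γ : Type} [Primcodable Γ] {Z : ℕ → ℕ} {𝒬 : Set (ℕ → Γ)}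
    (h : IsClosedIn Z 𝒬) : IsLimitClosed 𝒬 := by
  intro y hy
  by_contra hc
  obtain ⟨k, hk⟩ := IsSigmaRel.exists_agree h (a := ()) hc
  obtain ⟨z, hz, hzy⟩ := hy k
  exact hk z hzy hz

/-- The sequences that agree with `X` below `l` and have admissible values from `l` on. -/
def cylinder {σ : Type} (ok : ℕ → σ → Prop) (X : ℕ → σ) (l : ℕ) : Set (ℕ → σ) :=
  {X' | (∀ i < l, X' i = X i) ∧ ∀ i ≥ l, ok i (X' i)}

lemma cylinder_subset {σ : Type} {ok : ℕ → σ → Prop} {X X' : ℕ → σ} {l l' : ℕ}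
    (h : X' ∈ cylinder ok X l) (hl : l ≤ l') : cylinder ok X' l' ⊆ cylinder ok X l := by
  intro X'' h''
  refine ⟨fun i hi => (h''.1 i (by omega)).trans (h.1 i hi), fun i hi => ?_⟩
  by_cases hi' : i < l'
  · rw [h''.1 i hi']; exact h.2 i hi
  · exact h''.2 i (by omega)

/-- Only the finite list of values of `X` below `l` is used, so `X` itself need not be computable.
-/
lemma isSigmaOn_cylinder {Γ σ : Type} [Primcodable Γ] [Primcodable σ] {D : Set (ℕ → Γ)}
    {K : ℕ × σ → (ℕ → Γ) → Prop} (hK : IsSigmaOn D K) (X : ℕ → σ) (l : ℕ) :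
    IsSigmaOn D fun q x => (q.1 < l → q.2 = X q.1) ∧ (l ≤ q.1 → K q x) := by
  have h1 : PrimrecPred fun q : ℕ × σ => l ≤ q.1 :=
    Primrec.nat_le.comp (Primrec.const l) Primrec.fst
  have h2 : PrimrecPred fun q : ℕ × σ => (firstValues X l)[q.1]? = some q.2 :=
    Primrec.eq.comp (Primrec.list_getElem?.comp (Primrec.const _) Primrec.fst)
      (Primrec.option_some.comp Primrec.snd)
  refine ((IsSigmaOn.prim h2).or ((IsSigmaOn.prim h1).and hK)).of_iff ?_
  rintro ⟨i, c⟩ x -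
  by_cases hi : i < l
  · rw [getElem?_firstValues X hi]
    simp [hi, not_le.2 hi, eq_comm]
  · rw [List.getElem?_eq_none (by simpa using hi)]
    simp [hi, not_lt.1 hi]

/-- A forcing condition: a finite stem, given by a sequence and a length, and a `Π⁰₁` class
relative to `Z` whose sections at all admissible sequences extending the stem are nonempty. -/
structure Condition (σ τ : Type) [Primcodable σ] [Primcodable τ] (Z : ℕ → ℕ)
    (ok : ℕ → σ → Prop) where
  /-- The sequence giving the stem. -/
  stem : ℕ → σ
  /-- The length of the stem. -/
  len : ℕ
  /-- The class of points. -/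
  cls : Set (ℕ → σ × τ)
  ok_stem : ∀ i ≥ len, ok i (stem i)
  isClosedIn : IsClosedIn Z cls
  isFull : ∀ X ∈ cylinder ok stem len, ∃ Y, zipSeq X Y ∈ cls

namespace Condition

variable {σ τ : Type} [Primcodable σ] [Primcodable τ] {Z : ℕ → ℕ} {ok : ℕ → σ → Prop}

instance : Preorder (Condition σ τ Z ok) where
  le q p := p.len ≤ q.len ∧ q.stem ∈ cylinder ok p.stem p.len ∧ q.cls ⊆ p.cls
  le_refl p := ⟨le_rfl, ⟨fun _ _ => rfl, p.ok_stem⟩, subset_rfl⟩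
  le_trans p q s h₁ h₂ := ⟨h₂.1.trans h₁.1, cylinder_subset h₂.2.1 h₂.1 h₁.2.1,
    h₁.2.2.trans h₂.2.2⟩

/-- The cylinder of sequences extending the stem. -/
def cyl (p : Condition σ τ Z ok) : Set (ℕ → σ) :=
  cylinder ok p.stem p.len

/-- The points of the class that extend the stem. -/
def points (p : Condition σ τ Z ok) : Set (ℕ → σ × τ) :=
  {z ∈ p.cls | Prod.fst ∘ z ∈ p.cyl}

lemma stem_mem (p : Condition σ τ Z ok) : p.stem ∈ p.cyl :=
  ⟨fun _ _ => rfl, p.ok_stem⟩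

lemma cyl_subset {p q : Condition σ τ Z ok} (h : q ≤ p) : q.cyl ⊆ p.cyl :=
  cylinder_subset h.2.1 h.1

lemma points_subset {p q : Condition σ τ Z ok} (h : q ≤ p) : q.points ⊆ p.points :=
  fun _ hz => ⟨h.2.2 hz.1, cyl_subset h hz.2⟩

lemma points_nonempty (p : Condition σ τ Z ok) : p.points.Nonempty := by
  obtain ⟨Y, hY⟩ := p.isFull p.stem p.stem_mem
  exact ⟨_, hY, p.stem_mem⟩

lemma isLimitClosed_points (p : Condition σ τ Z ok) : IsLimitClosed p.points := by
  intro y hy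
  refine ⟨p.isClosedIn.isLimitClosed y fun k => ?_, fun i hi => ?_, fun i hi => ?_⟩
  · obtain ⟨z, hz, h⟩ := hy k
    exact ⟨z, hz.1, h⟩
  · obtain ⟨z, hz, h⟩ := hy (i + 1)
    simpa [h i (by omega)] using hz.2.1 i hi
  · obtain ⟨z, hz, h⟩ := hy (i + 1)
    simpa [h i (by omega)] using hz.2.2 i hi

/-- Lengthening the stem along an admissible sequence. -/
def extend (p : Condition σ τ Z ok) (X : ℕ → σ) (hX : X ∈ p.cyl) (k : ℕ) :
    Condition σ τ Z ok where
  stem := X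
  len := max p.len k
  cls := p.cls
  ok_stem i hi := hX.2 i (le_trans (le_max_left _ _) hi)
  isClosedIn := p.isClosedIn
  isFull X' hX' := p.isFull X' (cylinder_subset hX (le_max_left _ _) hX')

lemma extend_le (p : Condition σ τ Z ok) (X : ℕ → σ) (hX : X ∈ p.cyl) (k : ℕ) :
    p.extend X hX k ≤ p :=
  ⟨le_max_left _ _, hX, subset_rfl⟩

lemma eq_of_mem_extend {p : Condition σ τ Z ok} {X : ℕ → σ} {hX : X ∈ p.cyl} {k : ℕ}
    {X' : ℕ → σ} (h : X' ∈ (p.extend X hX k).cyl) : ∀ i < k, X' i = X i :=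
  fun i hi => h.1 i (lt_of_lt_of_le hi (le_max_right _ _))

/-- Shrinking the class of a condition, if it remains full. -/
def restrict (p : Condition σ τ Z ok) (P : (ℕ → σ × τ) → Prop)
    (hP : IsSigmaRel Z fun (_ : Unit) z => P z)
    (h : ∀ X ∈ p.cyl, ∃ Y, zipSeq X Y ∈ p.cls ∧ ¬ P (zipSeq X Y)) : Condition σ τ Z ok where
  stem := p.stem
  len := p.len
  cls := {z ∈ p.cls | ¬ P z}
  ok_stem := p.ok_stem
  isClosedIn := p.isClosedIn.sep hP
  isFull := h

lemma restrict_le (p : Condition σ τ Z ok) (P : (ℕ → σ × τ) → Prop)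
    (hP : IsSigmaRel Z fun (_ : Unit) z => P z)
    (h : ∀ X ∈ p.cyl, ∃ Y, zipSeq X Y ∈ p.cls ∧ ¬ P (zipSeq X Y)) : p.restrict P hP h ≤ p :=
  ⟨le_rfl, p.stem_mem, fun _ hz => hz.1⟩

variable [Finite τ] [Nonempty τ]

/-- Either an extension forces the open predicate `P` at all points, or some extension avoids it
at all points. -/
lemma isSigmaRel_forces {α : Type} [Primcodable α] {𝒬 : Set (ℕ → σ × τ)} (h : IsClosedIn Z 𝒬)
    {P : α → (ℕ → σ × τ) → Prop} (hP : IsSigmaRel Z P) :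
    IsSigmaRel Z fun a (X : ℕ → σ) => ∀ Y : ℕ → τ, zipSeq X Y ∉ 𝒬 ∨ P a (zipSeq X Y) :=
  IsSigmaRel.forall_seq (P := fun a z => z ∉ 𝒬 ∨ P a z)
    ((IsSigmaRel.subst h (f := fun _ : α => ()) (Primrec.const ())).or hP)

/-- That all points of `𝒬` over `X` satisfy `P` is witnessed by a finite part of `X`, which becomes
the new stem. Allowing `𝒬` to be larger than `p.cls` matters for the second point, where agreement
is known for an earlier class. -/
lemma exists_le_forall {p : Condition σ τ Z ok} {𝒬 : Set (ℕ → σ × τ)} (h𝒬 : IsClosedIn Z 𝒬)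
    (hp : p.cls ⊆ 𝒬) {P : (ℕ → σ × τ) → Prop}
    (hP : IsSigmaRel Z fun (_ : Unit) z => P z) {X : ℕ → σ} (hX : X ∈ p.cyl)
    (h : ∀ Y, zipSeq X Y ∈ 𝒬 → P (zipSeq X Y)) :
    ∃ q ≤ p, ∀ z ∈ q.points, P z := by
  obtain ⟨k, hk⟩ := (isSigmaRel_forces h𝒬 hP).exists_agree (a := ()) (z := X)
    (fun Y => imp_iff_not_or.1 (h Y))
  refine ⟨p.extend X hX k, p.extend_le X hX k, fun z hz => ?_⟩
  exact (hk (Prod.fst ∘ z) (eq_of_mem_extend hz.2) (Prod.snd ∘ z)).resolve_left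
    (fun hn => hn (hp hz.1))

/-- Density of the conditions that force `C` not to be the set enumerated by `R`. -/
lemma exists_le_avoid {C : Set ℕ} (hC : ¬ IsSigmaIn Z (· ∈ C))
    (hok : IsSigmaIn Z fun q : ℕ × σ => ok q.1 q.2) (p : Condition σ τ Z ok)
    {R : ℕ × List (ℕ × (σ × τ)) → Prop} (hR : PrimrecPred R) :
    ∃ q ≤ p, ∀ z ∈ q.points, ¬ ∀ n, n ∈ C ↔ ∃ k, R (n, firstValues (zipSeq Z z) k) := by
  have hW : IsSigmaRel Z fun n (z : ℕ → σ × τ) => ∃ k, R (n, firstValues (zipSeq Z z) k) :=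
    (IsSigmaOn.mk hR).of_iff fun n w hw => by
      change (∃ k, R (n, firstValues (zipSeq Z (Prod.snd ∘ w)) k)) ↔ _
      rw [← eq_zipSeq hw]
  have hU := isSigmaRel_forces p.isClosedIn hW
  -- The numbers that some `X` in the cylinder forces into the enumeration, whatever the `Y`. This
  -- set is `Σ⁰₁` in `Z`, hence not `C`.
  have hA : IsSigmaIn Z fun n => ∃ X : ℕ → σ,
      (∀ i, (i < p.len → X i = p.stem i) ∧ (p.len ≤ i → ok i (X i))) ∧
      ∀ Y, zipSeq X Y ∉ p.cls ∨ ∃ k, R (n, firstValues (zipSeq Z (zipSeq X Y)) k) := by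
    refine IsSigmaOn.exists_seq hU ?_ (isSigmaOn_cylinder hok p.stem p.len) ?_
    · rintro _ rfl _; rfl
    · exact fun _ _ i => ⟨p.stem i, fun _ => rfl, p.ok_stem i⟩
  have hne : ∃ n, ¬ (n ∈ C ↔ ∃ X ∈ p.cyl,
      ∀ Y, zipSeq X Y ∉ p.cls ∨ ∃ k, R (n, firstValues (zipSeq Z (zipSeq X Y)) k)) := by
    by_contra hc
    push Not at hc
    refine hC (hA.of_iff fun n _ _ => (hc n).trans (exists_congr fun X => and_congr_left' ?_))
    exact forall_and.symm
  obtain ⟨n, hn⟩ := hne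
  by_cases hnC : n ∈ C
  -- Here `n ∈ C` is forced by no `X`, so the points that never enumerate `n` still form a full
  -- class.
  · have hn' : ∀ X ∈ p.cyl, ∃ Y, zipSeq X Y ∈ p.cls ∧
        ¬ ∃ k, R (n, firstValues (zipSeq Z (zipSeq X Y)) k) := by
      simp only [hnC, true_iff] at hn
      push Not at hn ⊢
      exact hn
    refine ⟨p.restrict _ (hW.subst (f := fun _ : Unit => n) (Primrec.const n)) hn',
      p.restrict_le _ _ _, fun z hz h => hz.1.2 ((h n).1 hnC)⟩
  -- Here `n ∉ C` is forced by some `X`, and a finite part of it suffices.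
  · simp only [hnC, false_iff, not_not] at hn
    obtain ⟨X, hX, hXn⟩ := hn
    obtain ⟨q, hq, h⟩ := exists_le_forall p.isClosedIn subset_rfl
      (hW.subst (f := fun _ : Unit => n) (Primrec.const n)) hX (fun Y => imp_iff_not_or.2 (hXn Y))
    exact ⟨q, hq, fun z hz H => hnC ((H n).2 (h z hz))⟩

/-- Sufficiently generic points meet countably many dense requirements and do not
enumerate `C`. -/
theorem exists_generic [Finite σ] {C : Set ℕ} (hC : ¬ IsSigmaIn Z (· ∈ C))
    (hok : IsSigmaIn Z fun q : ℕ × σ => ok q.1 q.2) (p : Condition σ τ Z ok)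
    {ι : Type} [Countable ι] (req : ι → Set (ℕ → σ × τ))
    (h : ∀ q ≤ p, ∀ i, ∃ q' ≤ q, q'.points ⊆ req i) :
    ∃ z ∈ p.points, (∀ i, z ∈ req i) ∧ ¬ IsSigmaIn (joinSeq Z z) (· ∈ C) := by
  -- The trivial requirement `none` keeps the index type nonempty, so that it can be enumerated by
  -- `ℕ`.
  let κ := Option (ι ⊕ {R : ℕ × List (ℕ × (σ × τ)) → Prop // PrimrecPred R})
  let req' : κ → Set (ℕ → σ × τ)
    | none => Set.univ
    | some (.inl i) => req i
    | some (.inr R) => {z | ¬ ∀ n, n ∈ C ↔ ∃ k, R.1 (n, firstValues (zipSeq Z z) k)}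
  have step : ∀ (q : {q // q ≤ p}) (i : κ), ∃ q' : {q // q ≤ p}, q' ≤ q ∧ q'.1.points ⊆ req' i := by
    rintro ⟨q, hq⟩ (_ | i | R)
    · exact ⟨⟨q, hq⟩, le_rfl, Set.subset_univ _⟩
    · obtain ⟨q', h1, h2⟩ := h q hq i
      exact ⟨⟨q', h1.trans hq⟩, h1, h2⟩
    · obtain ⟨q', h1, h2⟩ := exists_le_avoid hC hok q R.2
      exact ⟨⟨q', h1.trans hq⟩, h1, h2⟩
  choose next hnext hreq using step
  obtain ⟨e, he⟩ := exists_surjective_nat κ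
  let s : ℕ → {q // q ≤ p} := fun n => n.rec ⟨p, le_rfl⟩ fun n q => next q (e n)
  obtain ⟨z, hz⟩ := exists_forall_mem_of_isLimitClosed (fun n => (s n).1.points)
    (fun n => isLimitClosed_points _) (fun n => points_subset (hnext (s n) (e n)))
    (fun n => points_nonempty _)
  have hz' : ∀ i, z ∈ req' i := by
    intro i
    obtain ⟨n, rfl⟩ := he i
    exact hreq (s n) (e n) (hz (n + 1))
  refine ⟨z, hz 0, fun i => hz' (some (.inl i)), fun hS => ?_⟩
  obtain ⟨R, hR, -, hRC⟩ := isSigmaIn_joinSeq hS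
  exact hz' (some (.inr ⟨R, hR⟩)) fun n => hRC n _ rfl

end Condition

/-! ### Constant components and opposing conditions. -/

lemma primrecPred_of_finite {α : Type} [Primcodable α] [Finite α] (p : α → Prop) :
    PrimrecPred p := by
  classical
  exact (Primrec.dom_finite fun a => decide (p a)).primrecPred

/-- The open set of sequences `z` for which some admissible section of a `Π⁰₁` class only has
points that are related to `z` at some place from `n` on. -/
lemma isSigmaRel_exists_section {σ τ Γ : Type} [Primcodable σ] [Primcodable τ] [Primcodable Γ]
    [Finite σ] [Finite τ] [Finite Γ] [Nonempty τ] {Z : ℕ → ℕ} {𝒬 : Set (ℕ → σ × τ)}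
    (h𝒬 : IsClosedIn Z 𝒬) {K : ℕ × σ → (ℕ → Γ) → Prop} (hK : IsSigmaRel Z K)
    (hne : ∀ z i, ∃ c, K (i, c) z) (X₀ : ℕ → σ) (l n : ℕ) (S : Γ → τ → Prop) :
    IsSigmaRel Z fun (_ : Unit) (z : ℕ → Γ) =>
      ∃ X ∈ cylinder (fun i c => K (i, c) z) X₀ l,
        ∀ Y, zipSeq X Y ∈ 𝒬 → ∃ m ≥ n, S (z m) (Y m) := by
  have h1 : IsSigmaRel Z fun (_ : Unit) (v : ℕ → (Γ × σ) × τ) =>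
      (fun q : (Γ × σ) × τ => (q.1.2, q.2)) ∘ v ∉ 𝒬 ∨ ∃ m ≥ n, S (v m).1.1 (v m).2 :=
    (IsSigmaRel.map h𝒬 ((Primrec.snd.comp Primrec.fst).pair Primrec.snd)).or
      (IsSigmaRel.exists_value (S := fun q : (Γ × σ) × τ => S q.1.1 q.2)
        (primrecPred_of_finite _) n)
  refine (h1.forall_seq.exists_seq
    (K := fun q z => (q.1 < l → q.2 = X₀ q.1) ∧ (l ≤ q.1 → K q z))
    (isSigmaOn_cylinder hK X₀ l) ?_).of_iff fun _ z => ?_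
  · intro z i
    by_cases hi : i < l
    · exact ⟨X₀ i, fun _ => rfl, fun h => absurd hi (not_lt.2 h)⟩
    · obtain ⟨c, hc⟩ := hne z i
      exact ⟨c, fun h => absurd h hi, fun _ => hc⟩
  · refine exists_congr fun X => and_congr ?_ ?_
    · exact forall_and.symm
    · exact forall_congr' fun Y => imp_iff_not_or

lemma fin_three_add_one_ne (c : Fin 3) : c + 1 ≠ c := by
  revert c; decide

/-- Conditions without restrictions on the first component. -/
abbrev FreeCondition (r : ℕ) (Z : ℕ → ℕ) : Type :=
  Condition (Fin 3) (Fin r → Fin 2) Z fun _ _ => True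

namespace FreeCondition

variable {r : ℕ} {Z : ℕ → ℕ}

lemma mem_cyl {p : FreeCondition r Z} {X : ℕ → Fin 3} :
    X ∈ p.cyl ↔ ∀ i < p.len, X i = p.stem i :=
  ⟨fun h => h.1, fun h => ⟨h, fun _ _ => trivial⟩⟩

/-- From some place on, all points of the condition have the same component `s`. -/
def IsConst (p : FreeCondition r Z) (s : Fin r) : Prop :=
  ∃ (c : ℕ → Fin 2) (n : ℕ), ∀ z ∈ p.points, ∀ m ≥ n, (z m).2 s = c m

/-- The points of the condition with component `s` equal to some `b` from some place on have
first components filling the cylinder. -/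
def HasConst (p : FreeCondition r Z) (s : Fin r) : Prop :=
  ∃ (b : ℕ → Fin 2) (n : ℕ), ∀ X ∈ p.cyl, ∃ Y, zipSeq X Y ∈ p.cls ∧ ∀ m ≥ n, Y m s = b m

/-- If a component can be made constant, then this can be done preserving that `C` is not
enumerable. -/
lemma exists_isConst {C : Set ℕ} (hC : ¬ IsSigmaIn Z (· ∈ C)) (q : FreeCondition r Z) {s : Fin r}
    (hs : q.HasConst s) : ∃ (z : ℕ → Fin 3 × (Fin r → Fin 2)) (p : FreeCondition r (joinSeq Z z)),
      ¬ IsSigmaIn (joinSeq Z z) (· ∈ C) ∧ p.points ⊆ q.points ∧ p.IsConst s := by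
  obtain ⟨b, n, hb⟩ := hs
  -- The given `b` may help to enumerate `C`, so it is not added to the oracle. The sequences `z`
  -- whose component `s` can play the role of `b` form a `Π⁰₁` class; by `hfull` it remains full,
  -- and a generic member replaces `b`.
  have hV := isSigmaRel_exists_section (Γ := Fin 3 × (Fin r → Fin 2)) (K := fun _ _ => True)
    q.isClosedIn (IsSigmaRel.prim (primrecPred_of_finite (α := Unit) (fun _ => True) |>.comp
      (Primrec.const ()))) (fun _ _ => ⟨0, trivial⟩) q.stem q.len n (fun c d => d s ≠ c.2 s)
  have hfull : ∀ X ∈ q.cyl, ∃ Y, zipSeq X Y ∈ q.cls ∧ ¬ ∃ X' ∈ cylinder (fun _ _ => True)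
      q.stem q.len, ∀ Y', zipSeq X' Y' ∈ q.cls → ∃ m ≥ n, Y' m s ≠ (zipSeq X Y m).2 s := by
    intro X hX
    obtain ⟨Y, hY, hYb⟩ := hb X hX
    refine ⟨Y, hY, ?_⟩
    rintro ⟨X', hX', h⟩
    obtain ⟨Y', hY', hYb'⟩ := hb X' hX'
    obtain ⟨m, hm, hne⟩ := h Y' hY'
    exact hne ((hYb' m hm).trans (hYb m hm).symm)
  obtain ⟨z, hz, -, hzC⟩ := Condition.exists_generic hC
    (IsSigmaOn.prim (primrecPred_of_finite (α := Unit) (fun _ => True) |>.comp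
      (Primrec.const ()))) (q.restrict _ hV hfull) (ι := Empty) (fun i => i.elim)
      (fun _ _ i => i.elim)
  have hz := hz.1.2
  push Not at hz
  have hW : IsSigmaRel (joinSeq Z z) fun (_ : Unit) (z' : ℕ → Fin 3 × (Fin r → Fin 2)) =>
      ∃ q : ℕ × (Fin 3 × (Fin r → Fin 2)) × (Fin 3 × (Fin r → Fin 2)),
        (z q.1 = q.2.1 ∧ z' q.1 = q.2.2) ∧ n ≤ q.1 ∧ q.2.2.2 s ≠ q.2.1.2 s := by
    refine IsSigmaRel.ex (P := fun (p : Unit × ℕ × (Fin 3 × (Fin r → Fin 2)) ×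
      (Fin 3 × (Fin r → Fin 2))) z' => (z p.2.1 = p.2.2.1 ∧ z' p.2.1 = p.2.2.2) ∧
        n ≤ p.2.1 ∧ p.2.2.2.2 s ≠ p.2.2.1.2 s) (.and (.and ?_ ?_) (.and (.prim ?_) (.prim ?_)))
    · exact (IsSigmaRel.of_isSigmaIn isSigmaIn_joinSeq_self).subst
        (f := fun p : Unit × ℕ × (Fin 3 × (Fin r → Fin 2)) × (Fin 3 × (Fin r → Fin 2)) =>
          (p.2.1, p.2.2.1))
        ((Primrec.fst.comp Primrec.snd).pair (Primrec.fst.comp (Primrec.snd.comp Primrec.snd)))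
    · exact IsSigmaRel.oracle.subst
        (f := fun p : Unit × ℕ × (Fin 3 × (Fin r → Fin 2)) × (Fin 3 × (Fin r → Fin 2)) =>
          (p.2.1, p.2.2.2))
        ((Primrec.fst.comp Primrec.snd).pair (Primrec.snd.comp (Primrec.snd.comp Primrec.snd)))
    · exact Primrec.nat_le.comp (Primrec.const n) (Primrec.fst.comp Primrec.snd)
    · exact (primrecPred_of_finite (fun c : (Fin 3 × (Fin r → Fin 2)) ×
        (Fin 3 × (Fin r → Fin 2)) => c.2.2 s ≠ c.1.2 s)).comp (Primrec.snd.comp Primrec.snd)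
  let p : FreeCondition r (joinSeq Z z) :=
    { stem := q.stem
      len := q.len
      cls := {z' ∈ q.cls | ¬ _}
      ok_stem := q.ok_stem
      isClosedIn := IsClosedIn.sep (IsSigmaRel.joinSeq q.isClosedIn) hW
      isFull := fun X hX => by
        obtain ⟨Y, hY, h⟩ := hz X hX
        refine ⟨Y, hY, ?_⟩
        rintro ⟨⟨m, c, d⟩, ⟨h1, h2⟩, hm, hne⟩
        dsimp only at h1 h2 hm hne
        subst h1 h2
        exact hne (h m hm) }
  refine ⟨z, p, hzC, fun z' hz' => ⟨hz'.1.1, hz'.2⟩, fun m => (z m).2 s, n, fun z' hz' m hm => ?_⟩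
  by_contra hne
  exact hz'.1.2 ⟨(m, z m, z' m), ⟨rfl, rfl⟩, hm, hne⟩

/-- A maximal set of components can be made constant. -/
lemma exists_forall_not_hasConst {C : Set ℕ} (hC : ¬ IsSigmaIn Z (· ∈ C))
    (p : FreeCondition r Z) : ∃ (Z' : ℕ → ℕ) (p' : FreeCondition r Z'),
      ¬ IsSigmaIn Z' (· ∈ C) ∧ (∃ ψ : ℕ → ℕ, Primrec ψ ∧ ψ ∘ Z' = Z) ∧ p'.points ⊆ p.points ∧
      ∀ s, p'.IsConst s ∨ ∀ q ≤ p', ¬ q.HasConst s := by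
  classical
  -- Induction on the number of components not yet constant. Each freezing changes the oracle, so
  -- the oracle varies in the induction, and `ψ` records how to recover `Z`.
  suffices H : ∀ (k : ℕ) (Z₁ : ℕ → ℕ) (p₁ : FreeCondition r Z₁), ¬ IsSigmaIn Z₁ (· ∈ C) →
      (Finset.univ.filter fun s => ¬ p₁.IsConst s).card = k →
      (∃ ψ : ℕ → ℕ, Primrec ψ ∧ ψ ∘ Z₁ = Z) → p₁.points ⊆ p.points →
      ∃ (Z' : ℕ → ℕ) (p' : FreeCondition r Z'),
      ¬ IsSigmaIn Z' (· ∈ C) ∧ (∃ ψ : ℕ → ℕ, Primrec ψ ∧ ψ ∘ Z' = Z) ∧ p'.points ⊆ p.points ∧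
      ∀ s, p'.IsConst s ∨ ∀ q ≤ p', ¬ q.HasConst s from
    H _ Z p hC rfl ⟨id, Primrec.id, rfl⟩ subset_rfl
  intro k
  induction k using Nat.strong_induction_on with
  | _ k ih =>
    intro Z₁ p₁ hC₁ hk hψ hp
    by_cases hdone : ∀ s, p₁.IsConst s ∨ ∀ q ≤ p₁, ¬ q.HasConst s
    · exact ⟨Z₁, p₁, hC₁, hψ, hp, hdone⟩
    push Not at hdone
    obtain ⟨s, hs, q, hq, hqs⟩ := hdone
    obtain ⟨z, p₂, hC₂, hp₂, hs₂⟩ := exists_isConst hC₁ q hqs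
    have hsub : p₂.points ⊆ p₁.points := hp₂.trans (Condition.points_subset hq)
    obtain ⟨ψ, hψ, rfl⟩ := hψ
    refine ih _ ?_ _ p₂ hC₂ rfl ⟨fun m => ψ m.unpair.1, hψ.comp (Primrec.fst.comp
      Primrec.unpair), ?_⟩ (hsub.trans hp)
    · rw [← hk]
      refine Finset.card_lt_card ⟨fun t ht => ?_, fun h => ?_⟩
      · simp only [Finset.mem_filter, Finset.mem_univ, true_and] at ht ⊢
        rintro ⟨c, n, h⟩
        exact ht ⟨c, n, fun z hz => h z (hsub hz)⟩
      · have := h (x := s) (by simpa using hs)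
        simp [hs₂] at this
    · ext n; simp [joinSeq]

/-- For each point of `q`, the points of `p` whose first component is different from it beyond the
stems, and whose component `s` is different from it from `n` on, have first components filling
the cylinder as far as possible. -/
def Opposes (s : Fin r) (n : ℕ) (q p : FreeCondition r Z) : Prop :=
  q.len = p.len ∧ ∀ z ∈ q.points, ∀ X ∈ p.cyl, (∀ i ≥ p.len, X i ≠ (z i).1) →
    ∃ Y, zipSeq X Y ∈ p.cls ∧ ∀ m ≥ n, Y m s ≠ (z m).2 s

/-- When the stem of `q` grows, the stem of `p` is lengthened to match, with new values shifted by
one. They differ from the first components of all points of `q'`, so the opposition survives. -/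
lemma Opposes.exists_le {s : Fin r} {n : ℕ} {q p q' : FreeCondition r Z} (h : Opposes s n q p)
    (hq : q' ≤ q) : ∃ p' ≤ p, Opposes s n q' p' := by
  let X' : ℕ → Fin 3 := fun i => if i < p.len then p.stem i else q'.stem i + 1
  have hX' : X' ∈ p.cyl := mem_cyl.2 fun i hi => if_pos hi
  have hlen : (p.extend X' hX' q'.len).len = q'.len := max_eq_right (h.1 ▸ hq.1)
  refine ⟨p.extend X' hX' q'.len, p.extend_le _ _ _, hlen.symm, fun z hz X hX hne => ?_⟩
  refine h.2 z (Condition.points_subset hq hz) X (Condition.cyl_subset (p.extend_le _ _ _) hX)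
    fun i hi => ?_
  by_cases hi' : i < q'.len
  · have h1 : X i = X' i := Condition.eq_of_mem_extend hX i hi'
    have h2 : (z i).1 = q'.stem i := hz.2.1 i hi'
    rw [h1, h2]
    simpa only [X', if_neg (not_lt.2 hi)] using fin_three_add_one_ne _
  · exact hne i (by rw [hlen]; omega)

/-- Two steps of opposition make the component `s` constant. -/
lemma Opposes.hasConst {s : Fin r} {n n' : ℕ} {q p p' : FreeCondition r Z} (h : Opposes s n q p)
    (h' : Opposes s n' p p') : p'.HasConst s := by
  obtain ⟨z, hz⟩ := q.points_nonempty
  refine ⟨fun m => (z m).2 s, max n n', fun X hX => ?_⟩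
  -- This is where three colours are needed: `X₁` must avoid both the fixed point `z` and the
  -- arbitrary `X`.
  have third : ∀ a b : Fin 3, ∃ c, c ≠ a ∧ b ≠ c := by decide
  choose t ht using third
  let X₁ : ℕ → Fin 3 := fun i => if i < p.len then p.stem i else t (z i).1 (X i)
  have hX₁ : X₁ ∈ p.cyl := mem_cyl.2 fun i hi => if_pos hi
  have hX₁' : ∀ i ≥ p.len, X₁ i = t (z i).1 (X i) := fun i hi => if_neg (not_lt.2 hi)
  obtain ⟨Y₁, hY₁, h1⟩ := h.2 z hz X₁ hX₁ fun i hi => by rw [hX₁' i hi]; exact (ht _ _).1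
  obtain ⟨Y, hY, h2⟩ := h'.2 (zipSeq X₁ Y₁) ⟨hY₁, hX₁⟩ X hX fun i hi => by
    change X i ≠ X₁ i
    rw [hX₁' i (h'.1 ▸ hi)]
    exact (ht _ _).2
  refine ⟨Y, hY, fun m hm => ?_⟩
  have e1 := h1 m (le_trans (le_max_left _ _) hm)
  have e2 : Y m s ≠ Y₁ m s := h2 m (le_trans (le_max_right _ _) hm)
  change Y m s = (z m).2 s
  revert e1 e2
  generalize Y m s = a
  generalize Y₁ m s = b
  generalize (z m).2 s = c
  revert a b c; decide

/-- Some condition below `p` has no opposing pairs below it, for components that cannot be made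
constant. -/
lemma exists_forall_not_opposes (p : FreeCondition r Z) : ∃ p' ≤ p, ∀ s,
    (∀ q ≤ p, ¬ q.HasConst s) → ∀ q ≤ p', ∀ q' ≤ p', ∀ n, ¬ Opposes s n q q' := by
  classical
  -- The components in which a condition opposes something below `p` only increase as it is
  -- strengthened. At `p'` they are as many as possible, hence stable below `p'`.
  let Out : FreeCondition r Z → Fin r → Prop := fun q s => ∃ p₂ ≤ p, ∃ n, Opposes s n q p₂
  have hmono : ∀ q q', q' ≤ q → ∀ s, Out q s → Out q' s := by
    rintro q q' hq s ⟨p₂, hp₂, n, h⟩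
    obtain ⟨p₃, h3, h⟩ := h.exists_le hq
    exact ⟨p₃, h3.trans hp₂, n, h⟩
  obtain ⟨p', hp', hmin⟩ := WellFounded.has_min
    (measure fun q => (Finset.univ.filter fun s => ¬ Out q s).card).wf {q | q ≤ p} ⟨p, by simp⟩
  have hp' : p' ≤ p := by simpa using hp'
  have hmax : ∀ q ≤ p', ∀ s, Out q s → Out p' s := by
    intro q hq s hs
    by_contra hn
    refine hmin q (by simpa using le_trans hq hp') (Finset.card_lt_card ⟨fun t ht => ?_, fun h => ?_⟩)
    · simp only [Finset.mem_filter, Finset.mem_univ, true_and] at ht ⊢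
      exact fun h => ht (hmono _ _ hq t h)
    · have := h (x := s) (by simpa using hn)
      simp [hs] at this
  refine ⟨p', hp', fun s hs q hq q' hq' n h => ?_⟩
  -- By stability `p'` opposes some `p₂`, so `q'` opposes some `p₃` below it. Then `q`, `q'`, `p₃`
  -- is a chain of two oppositions, which would freeze `s` below `p`.
  obtain ⟨p₂, hp₂, n₂, h₂⟩ := hmax q hq s ⟨q', le_trans hq' hp', n, h⟩
  obtain ⟨p₃, hp₃, h₃⟩ := h₂.exists_le hq'
  exact hs p₃ (hp₃.trans hp₂) (h.hasConst h₃)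

end FreeCondition

/-! ### The two points of a solution. -/

namespace FreeCondition

variable {r : ℕ} {Z : ℕ → ℕ}

/-- Some sequence that extends `X₀ ↾ l` and differs from the first component of `z` beyond `l`
only has points, in the class `𝒬`, that agree with `z` in component `s` somewhere from `n` on. -/
def ForcesAgree (𝒬 : Set (ℕ → Fin 3 × (Fin r → Fin 2))) (X₀ : ℕ → Fin 3) (l : ℕ) (s : Fin r)
    (n : ℕ) (z : ℕ → Fin 3 × (Fin r → Fin 2)) : Prop :=
  ∃ X ∈ cylinder (fun i c => c ≠ (z i).1) X₀ l,
    ∀ Y, zipSeq X Y ∈ 𝒬 → ∃ m ≥ n, Y m s = (z m).2 s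

lemma isSigmaRel_forcesAgree {𝒬 : Set (ℕ → Fin 3 × (Fin r → Fin 2))} (h𝒬 : IsClosedIn Z 𝒬)
    (X₀ : ℕ → Fin 3) (l : ℕ) (s : Fin r) (n : ℕ) :
    IsSigmaRel Z fun (_ : Unit) z => ForcesAgree 𝒬 X₀ l s n z := by
  have hK : IsSigmaRel Z fun (p : ℕ × Fin 3) (z : ℕ → Fin 3 × (Fin r → Fin 2)) =>
      p.2 ≠ (z p.1).1 := by
    have := IsSigmaRel.ex (Z := Z) (P := fun (p : (ℕ × Fin 3) × (Fin 3 × (Fin r → Fin 2)))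
      (z : ℕ → Fin 3 × (Fin r → Fin 2)) => z p.1.1 = p.2 ∧ p.1.2 ≠ p.2.1) (.and
        (IsSigmaRel.oracle.subst
          (f := fun p : (ℕ × Fin 3) × (Fin 3 × (Fin r → Fin 2)) => (p.1.1, p.2))
          ((Primrec.fst.comp Primrec.fst).pair Primrec.snd))
        (.prim ((primrecPred_of_finite (fun q : Fin 3 × (Fin 3 × (Fin r → Fin 2)) =>
          q.1 ≠ q.2.1)).comp (f := fun p : (ℕ × Fin 3) × (Fin 3 × (Fin r → Fin 2)) =>
            (p.1.2, p.2)) ((Primrec.snd.comp Primrec.fst).pair Primrec.snd))))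
    exact this.of_iff fun p z => by simp
  refine isSigmaRel_exists_section h𝒬 hK (fun z i => ?_) X₀ l n (fun c d => d s = c.2 s)
  exact ⟨(z i).1 + 1, fin_three_add_one_ne _⟩

/-- Density of the requirements on the first point of a solution. -/
lemma exists_le_forcesAgree {p q : FreeCondition r Z} (hq : q ≤ p) {s : Fin r}
    (hp : ∀ q ≤ p, ∀ q' ≤ p, ∀ n, ¬ Opposes s n q q') {X₀ : ℕ → Fin 3} {l : ℕ} (hl : p.len ≤ l)
    (hX₀ : X₀ ∈ p.cyl) (n : ℕ) :
    ∃ q' ≤ q, ∀ z ∈ q'.points, ForcesAgree p.cls X₀ l s n z := by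
  let L := max q.len l
  -- The stem `X₀ ↾ l` is prolonged to the common length `L` by values avoiding the stem of `q`.
  let X₁ : ℕ → Fin 3 := fun i => if i < l then X₀ i else q.stem i + 1
  have hX₁ : X₁ ∈ p.cyl := mem_cyl.2 fun i hi =>
    (if_pos (lt_of_lt_of_le hi hl)).trans (mem_cyl.1 hX₀ i hi)
  let q₁ := q.extend q.stem q.stem_mem L
  have hq₁ : q₁ ≤ q := q.extend_le _ _ _
  let p₁ := p.extend X₁ hX₁ L
  have hlen : q₁.len = L := max_eq_right (le_max_left _ _)
  have hlen' : p₁.len = L := max_eq_right (hl.trans (le_max_right _ _))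
  have hV := isSigmaRel_forcesAgree p.isClosedIn X₁ L s n
  have key : ∃ X ∈ q₁.cyl, ∀ Y, zipSeq X Y ∈ q₁.cls → ForcesAgree p.cls X₁ L s n (zipSeq X Y) := by
    -- Otherwise the points of `q₁` that do not force agreement form a full class, and the resulting
    -- condition opposes `p₁`.
    by_contra hc
    push Not at hc
    refine hp (q₁.restrict _ hV hc) ((q₁.restrict_le _ _ _).trans (hq₁.trans hq)) p₁
      (p.extend_le _ _ _) n ⟨hlen.trans hlen'.symm, fun z hz X hX hne => ?_⟩
    by_contra hY
    push Not at hY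
    refine hz.1.2 ⟨X, ⟨fun i hi => ?_, fun i hi => hne i (by rw [hlen']; exact hi)⟩, hY⟩
    exact mem_cyl.1 hX i (by rw [hlen']; exact hi)
  obtain ⟨X, hX, hXY⟩ := key
  obtain ⟨q', hq', h⟩ := Condition.exists_le_forall q₁.isClosedIn subset_rfl hV hX hXY
  refine ⟨q', hq'.trans hq₁, fun z hz => ?_⟩
  obtain ⟨X', hX', hY'⟩ := h z hz
  -- Between `l` and `L` the sequence `X'` follows `X₁`, which avoids the first component of `z`
  -- there; so the stem may be cut back to `X₀ ↾ l`.
  refine ⟨X', ⟨fun i hi => ?_, fun i hi => ?_⟩, hY'⟩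
  · exact (hX'.1 i (lt_of_lt_of_le hi (le_max_right _ _))).trans (if_pos hi)
  · by_cases hiL : i < L
    · have e : (z i).1 = q.stem i :=
        (Condition.points_subset hq' hz).2.1 i (by rw [hlen]; exact hiL)
      change X' i ≠ (z i).1
      rw [hX'.1 i hiL, e]
      simpa only [X₁, if_neg (not_lt.2 hi)] using fin_three_add_one_ne _
    · exact hX'.2 i (not_lt.1 hiL)

/-- The first point of a solution. -/
lemma exists_first_point {C : Set ℕ} (hC : ¬ IsSigmaIn Z (· ∈ C)) (p : FreeCondition r Z)
    (S : Set (Fin r)) (hp : ∀ s ∈ S, ∀ q ≤ p, ∀ q' ≤ p, ∀ n, ¬ Opposes s n q q') :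
    ∃ z ∈ p.points, ¬ IsSigmaIn (joinSeq Z z) (· ∈ C) ∧
      ∀ X₀ ∈ p.cyl, ∀ l ≥ p.len, ∀ s ∈ S, ∀ n, ForcesAgree p.cls X₀ l s n z := by
  have hok : IsSigmaIn Z fun _ : ℕ × Fin 3 => True :=
    IsSigmaOn.prim (primrecPred_of_finite (α := Unit) (fun _ => True) |>.comp (Primrec.const ()))
  -- Coding stems by lists keeps the requirements countable; the default `0` lies beyond the stem
  -- and has no effect.
  let seq : List (Fin 3) → ℕ → Fin 3 := fun L i => L.getD i 0
  obtain ⟨z, hz, hreq, hzC⟩ := Condition.exists_generic hC hok p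
    (ι := List (Fin 3) × Fin r × ℕ) (fun t => {z | seq t.1 ∈ p.cyl → p.len ≤ t.1.length →
      t.2.1 ∈ S → ForcesAgree p.cls (seq t.1) t.1.length t.2.1 t.2.2 z}) (by
      rintro q hq ⟨L, s, n⟩
      by_cases h : seq L ∈ p.cyl ∧ p.len ≤ L.length ∧ s ∈ S
      · obtain ⟨q', hq', hz⟩ := exists_le_forcesAgree hq (hp s h.2.2) h.2.1 h.1 n
        exact ⟨q', hq', fun z hzq _ _ _ => hz z hzq⟩
      · exact ⟨q, le_rfl, fun z _ h1 h2 h3 => absurd ⟨h1, h2, h3⟩ h⟩)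
  refine ⟨z, hz, hzC, fun X₀ hX₀ l hl s hs n => ?_⟩
  have e : ∀ i < l, seq (firstValues X₀ l) i = X₀ i := by
    intro i hi
    simp [seq, List.getD_eq_getElem?_getD, getElem?_firstValues X₀ hi]
  obtain ⟨X, hX, hY⟩ := hreq (firstValues X₀ l, s, n)
    (mem_cyl.2 fun i hi => (e i (lt_of_lt_of_le hi hl)).trans (mem_cyl.1 hX₀ i hi))
    (by simpa using hl) hs
  simp only [length_firstValues] at hX
  exact ⟨X, ⟨fun i hi => (hX.1 i hi).trans (e i hi), hX.2⟩, hY⟩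

/-- The second point of a solution. -/
lemma exists_second_point {C : Set ℕ} (p : FreeCondition r Z)
    (S : Set (Fin r)) {z : ℕ → Fin 3 × (Fin r → Fin 2)} (hC : ¬ IsSigmaIn (joinSeq Z z) (· ∈ C))
    (hz : ∀ X₀ ∈ p.cyl, ∀ l ≥ p.len, ∀ s ∈ S, ∀ n, ForcesAgree p.cls X₀ l s n z) :
    ∃ z' ∈ p.points, (∀ i ≥ p.len, (z' i).1 ≠ (z i).1) ∧
      (∀ s ∈ S, ∀ n, ∃ m ≥ n, (z' m).2 s = (z m).2 s) ∧
      ¬ IsSigmaIn (joinSeq (joinSeq Z z) z') (· ∈ C) := by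
  let ok : ℕ → Fin 3 → Prop := fun i c => c ≠ (z i).1
  have hself : IsSigmaIn (joinSeq Z z) fun q : ℕ × (Fin 3 × (Fin r → Fin 2)) => z q.1 = q.2 :=
    isSigmaIn_joinSeq_self
  have hok : IsSigmaIn (joinSeq Z z) fun q : ℕ × Fin 3 => ok q.1 q.2 := by
    have := IsSigmaOn.ex (D := {joinSeq Z z})
      (P := fun (q : (ℕ × Fin 3) × (Fin 3 × (Fin r → Fin 2))) _ => z q.1.1 = q.2 ∧ q.1.2 ≠ q.2.1)
      (.and (hself.subst (f := fun q : (ℕ × Fin 3) × (Fin 3 × (Fin r → Fin 2)) => (q.1.1, q.2))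
        ((Primrec.fst.comp Primrec.fst).pair Primrec.snd))
        (.prim ((primrecPred_of_finite (fun q : Fin 3 × (Fin 3 × (Fin r → Fin 2)) =>
          q.1 ≠ q.2.1)).comp (f := fun p : (ℕ × Fin 3) × (Fin 3 × (Fin r → Fin 2)) =>
            (p.1.2, p.2)) ((Primrec.snd.comp Primrec.fst).pair Primrec.snd))))
    exact this.of_iff fun p z _ => by simp [ok]
  let stem : ℕ → Fin 3 := fun i => if i < p.len then p.stem i else (z i).1 + 1
  have hcyl : ∀ X ∈ cylinder ok stem p.len, X ∈ p.cyl := fun X hX =>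
    mem_cyl.2 fun i hi => (hX.1 i hi).trans (if_pos hi)
  let p₁ : Condition (Fin 3) (Fin r → Fin 2) (joinSeq Z z) ok :=
    { stem := stem
      len := p.len
      cls := p.cls
      ok_stem := fun i hi => by
        simpa only [ok, stem, if_neg (not_lt.2 hi)] using fin_three_add_one_ne _
      isClosedIn := IsSigmaRel.joinSeq p.isClosedIn
      isFull := fun X hX => p.isFull X (hcyl X hX) }
  obtain ⟨z', hz', hreq, hzC⟩ := Condition.exists_generic hC hok p₁ (ι := S × ℕ)
    (fun t => {z' | ∃ m ≥ t.2, (z' m).2 t.1 = (z m).2 t.1}) (by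
      rintro q hq ⟨⟨s, hs⟩, n⟩
      -- The property of `z`, applied to the stem of `q`, gives an admissible `X` over which all
      -- points of the original class agree with `z` late. Those of the smaller class `q.cls`,
      -- closed only relative to `Z ⊕ z`, then do so too.
      obtain ⟨X, hX, hY⟩ := hz q.stem (hcyl _ (Condition.cyl_subset hq q.stem_mem)) q.len hq.1 s hs n
      have hW : IsSigmaRel (joinSeq Z z) fun (_ : Unit) (z' : ℕ → Fin 3 × (Fin r → Fin 2)) =>
          ∃ m, n ≤ m ∧ ∃ c, z m = c ∧ ∃ c', z' m = c' ∧ c'.2 s = c.2 s := by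
        refine IsSigmaRel.ex (P := fun (a : Unit × ℕ) (z' : ℕ → Fin 3 × (Fin r → Fin 2)) =>
          n ≤ a.2 ∧ ∃ c, z a.2 = c ∧ ∃ c', z' a.2 = c' ∧ c'.2 s = c.2 s) (.and (.prim ?_) ?_)
        · exact Primrec.nat_le.comp (Primrec.const n) Primrec.snd
        refine IsSigmaRel.ex (P := fun (a : (Unit × ℕ) × (Fin 3 × (Fin r → Fin 2)))
          (z' : ℕ → Fin 3 × (Fin r → Fin 2)) =>
          z a.1.2 = a.2 ∧ ∃ c', z' a.1.2 = c' ∧ c'.2 s = a.2.2 s) (.and ?_ ?_)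
        · exact (IsSigmaRel.of_isSigmaIn hself).subst
            (f := fun a : (Unit × ℕ) × (Fin 3 × (Fin r → Fin 2)) => (a.1.2, a.2))
            ((Primrec.snd.comp Primrec.fst).pair Primrec.snd)
        refine IsSigmaRel.ex (P := fun (a : ((Unit × ℕ) × (Fin 3 × (Fin r → Fin 2))) ×
          (Fin 3 × (Fin r → Fin 2))) (z' : ℕ → Fin 3 × (Fin r → Fin 2)) =>
          z' a.1.1.2 = a.2 ∧ a.2.2 s = a.1.2.2 s) (.and ?_ (.prim ?_))
        · exact IsSigmaRel.oracle.subst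
            (f := fun a : ((Unit × ℕ) × (Fin 3 × (Fin r → Fin 2))) ×
              (Fin 3 × (Fin r → Fin 2)) => (a.1.1.2, a.2))
            ((Primrec.snd.comp (Primrec.fst.comp Primrec.fst)).pair Primrec.snd)
        · exact (primrecPred_of_finite (fun q : (Fin 3 × (Fin r → Fin 2)) ×
            (Fin 3 × (Fin r → Fin 2)) => q.2.2 s = q.1.2 s)).comp
            ((Primrec.snd.comp Primrec.fst).pair Primrec.snd)
      have hW' : IsSigmaRel (joinSeq Z z) fun (_ : Unit) (z' : ℕ → Fin 3 × (Fin r → Fin 2)) =>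
          ∃ m ≥ n, (z' m).2 s = (z m).2 s := hW.of_iff fun _ z' => by simp
      obtain ⟨q', hq', h⟩ := Condition.exists_le_forall (p := q) p₁.isClosedIn hq.2.2 hW'
        (X := X) hX hY
      exact ⟨q', hq', h⟩)
  exact ⟨z', ⟨hz'.1, hcyl _ hz'.2⟩, hz'.2.2, fun s hs n => hreq (⟨s, hs⟩, n), hzC⟩

/-- Below each condition there is a pair of points as required of solutions. -/
theorem exists_solution {C : Set ℕ} (hC : ¬ IsSigmaIn Z (· ∈ C)) (p : FreeCondition r Z) :
    ∃ z ∈ p.points, ∃ z' ∈ p.points, (∃ l, ∀ i ≥ l, (z' i).1 ≠ (z i).1) ∧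
      (∀ s n, ∃ m ≥ n, (z' m).2 s = (z m).2 s) ∧
      ¬ IsSigmaIn (joinSeq (joinSeq Z z) z') (· ∈ C) := by
  obtain ⟨Z₁, p₁, hC₁, ⟨ψ, hψ, rfl⟩, hp₁, hconst⟩ := exists_forall_not_hasConst hC p
  obtain ⟨p₂, hp₂, hopp⟩ := exists_forall_not_opposes p₁
  let S : Set (Fin r) := {s | ∀ q ≤ p₁, ¬ q.HasConst s}
  obtain ⟨z, hz, hzC, hforce⟩ := exists_first_point hC₁ p₂ S hopp
  obtain ⟨z', hz', hne, hagree, hzC'⟩ := exists_second_point p₂ S hzC hforce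
  have hsub := Condition.points_subset hp₂
  refine ⟨z, hp₁ (hsub hz), z', hp₁ (hsub hz'), ⟨_, hne⟩, fun s n => ?_, fun h => hzC' ?_⟩
  · rcases hconst s with ⟨c, n', hc⟩ | hs
    · refine ⟨max n n', le_max_left _ _, ?_⟩
      rw [hc z (hsub hz) _ (le_max_right _ _), hc z' (hsub hz') _ (le_max_right _ _)]
    · exact hagree s hs n
  -- Inside the join, `Z₁` can be replaced by its primitive recursive image `ψ ∘ Z₁`, the original
  -- oracle.
  · refine IsSigmaOn.map (D' := {joinSeq (joinSeq (ψ ∘ Z₁) z) z'})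
      (φ := fun m => Nat.pair (Nat.pair (ψ m.unpair.1.unpair.1) m.unpair.1.unpair.2) m.unpair.2)
      h ?_ ?_
    · have h1 := Primrec.fst.comp Primrec.unpair
      have h2 := Primrec.snd.comp Primrec.unpair
      exact Primrec₂.natPair.comp (Primrec₂.natPair.comp (hψ.comp (h1.comp h1)) (h2.comp h1)) h2
    · rintro _ rfl
      ext n
      simp [joinSeq]

end FreeCondition

/-! ### From Turing reducibility to `Σ⁰₁` graphs. -/

namespace IsSigmaIn

variable {α β : Type} [Primcodable α] [Primcodable β] {Z : ℕ → ℕ} {p q : α → Prop}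

lemma of_iff (h : IsSigmaIn Z p) (e : ∀ a, q a ↔ p a) : IsSigmaIn Z q :=
  IsSigmaOn.of_iff h fun a _ _ => e a

lemma and (hp : IsSigmaIn Z p) (hq : IsSigmaIn Z q) : IsSigmaIn Z fun a => p a ∧ q a :=
  IsSigmaOn.and hp hq

lemma or (hp : IsSigmaIn Z p) (hq : IsSigmaIn Z q) : IsSigmaIn Z fun a => p a ∨ q a :=
  IsSigmaOn.or hp hq

lemma prim (hp : PrimrecPred p) : IsSigmaIn Z p :=
  IsSigmaOn.prim hp

lemma subst {p : β → Prop} (hp : IsSigmaIn Z p) {f : α → β} (hf : Primrec f) :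
    IsSigmaIn Z fun a => p (f a) :=
  IsSigmaOn.subst hp hf

lemma ex {p : α × β → Prop} (hp : IsSigmaIn Z p) : IsSigmaIn Z fun a => ∃ b, p (a, b) :=
  IsSigmaOn.ex (P := fun q _ => p q) hp

lemma all {p : α × β → Prop} (hp : IsSigmaIn Z p) {l : α → List β} (hl : Primrec l) :
    IsSigmaIn Z fun a => ∀ b ∈ l a, p (a, b) :=
  IsSigmaOn.all (P := fun q _ => p q) hp hl

lemma eq_prim {f g : α → β} (hf : Primrec f) (hg : Primrec g) : IsSigmaIn Z fun a => f a = g a :=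
  prim (Primrec.eq.comp hf hg)

end IsSigmaIn

/-- Iteration of a partial function through the list of its intermediate values. -/
lemma mem_rec_iff_exists_list (f : Part ℕ) (h : ℕ → ℕ → Part ℕ) (n y : ℕ) :
    y ∈ (n.rec f fun i IH => IH >>= fun u => h i u : Part ℕ) ↔
      ∃ L : List ℕ, (∃ v, L[0]? = some v ∧ v ∈ f) ∧
        (∀ i ∈ List.range n, ∃ u v, (L[i]? = some u ∧ L[i + 1]? = some v) ∧ v ∈ h i u) ∧
        L[n]? = some y := by
  constructor
  · suffices H : ∀ n y, y ∈ (n.rec f fun i IH => IH >>= fun u => h i u : Part ℕ) →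
        ∃ L : List ℕ, L.length = n + 1 ∧ (∃ v, L[0]? = some v ∧ v ∈ f) ∧
        (∀ i ∈ List.range n, ∃ u v, (L[i]? = some u ∧ L[i + 1]? = some v) ∧ v ∈ h i u) ∧
        L[n]? = some y by
      intro hy
      obtain ⟨L, -, hL⟩ := H n y hy
      exact ⟨L, hL⟩
    intro n
    induction n with
    | zero => exact fun y hy => ⟨[y], rfl, ⟨y, rfl, hy⟩, by simp, rfl⟩
    | succ n ih =>
      intro y hy
      simp only [Part.bind_eq_bind, Part.mem_bind_iff] at hy
      obtain ⟨u, hu, hy⟩ := hy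
      obtain ⟨L, hlen, ⟨v, hv, hvf⟩, hL, hn⟩ := ih u hu
      have old : ∀ i < n + 1, (L ++ [y])[i]? = L[i]? := fun i hi =>
        List.getElem?_append_left (by omega)
      have new : (L ++ [y])[n + 1]? = some y := by
        rw [List.getElem?_append_right (by omega)]
        simp [hlen]
      refine ⟨L ++ [y], by simp [hlen], ⟨v, by rw [old 0 (by omega), hv], hvf⟩, fun i hi => ?_, new⟩
      have hi : i < n + 1 := by simpa using hi
      rcases Nat.lt_succ_iff_lt_or_eq.1 hi with hi' | rfl
      · obtain ⟨u', v', ⟨h1, h2⟩, h3⟩ := hL i (by simpa using hi')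
        exact ⟨u', v', ⟨by rw [old i hi, h1], by rw [old (i + 1) (by omega), h2]⟩, h3⟩
      · exact ⟨u, y, ⟨by rw [old i hi, hn], new⟩, hy⟩
  · rintro ⟨L, ⟨v, hv, hvf⟩, hL, hn⟩
    suffices H : ∀ j ≤ n, ∀ w, L[j]? = some w →
        w ∈ (j.rec f fun i IH => IH >>= fun u => h i u : Part ℕ) from H n le_rfl y hn
    intro j
    induction j with
    | zero =>
      intro _ w hw
      rw [hv] at hw
      exact Option.some_injective _ hw ▸ hvf
    | succ j ih =>
      intro hj w hw
      obtain ⟨u, v', ⟨h1, h2⟩, h3⟩ := hL j (by simpa using hj)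
      rw [hw] at h2
      simp only [Part.bind_eq_bind, Part.mem_bind_iff]
      exact ⟨u, ih (by omega) u h1, Option.some_injective _ h2 ▸ h3⟩

/-- If the graph of the oracle is `Σ⁰₁` relative to `Z`, then so is the graph of each partial
function recursive in the oracle. -/
lemma isSigmaIn_of_recursiveIn {Z : ℕ → ℕ} {g : ℕ →. ℕ}
    (hg : IsSigmaIn Z fun p : ℕ × ℕ => p.2 ∈ g p.1) {f : ℕ →. ℕ} (hf : Nat.RecursiveIn {g} f) :
    IsSigmaIn Z fun p : ℕ × ℕ => p.2 ∈ f p.1 := by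
  have unp1 := Primrec.fst.comp Primrec.unpair
  have unp2 := Primrec.snd.comp Primrec.unpair
  induction hf with
  | zero =>
    exact (IsSigmaIn.eq_prim Primrec.snd (Primrec.const 0)).of_iff fun p => Part.mem_some_iff
  | succ =>
    exact (IsSigmaIn.eq_prim Primrec.snd (Primrec.succ.comp Primrec.fst)).of_iff
      fun p => Part.mem_some_iff
  | left =>
    exact (IsSigmaIn.eq_prim Primrec.snd (unp1.comp Primrec.fst)).of_iff
      fun p => Part.mem_some_iff
  | right =>
    exact (IsSigmaIn.eq_prim Primrec.snd (unp2.comp Primrec.fst)).of_iff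
      fun p => Part.mem_some_iff
  | oracle g' hg' =>
    rw [Set.mem_singleton_iff] at hg'
    exact hg' ▸ hg
  | @pair f h _ _ ihf ihh =>
    have := IsSigmaIn.ex (Z := Z) (p := fun q : (ℕ × ℕ) × (ℕ × ℕ) =>
      (q.2.1 ∈ f q.1.1 ∧ q.2.2 ∈ h q.1.1) ∧ Nat.pair q.2.1 q.2.2 = q.1.2) (.and (.and
        (ihf.subst (f := fun q : (ℕ × ℕ) × (ℕ × ℕ) => (q.1.1, q.2.1))
          ((Primrec.fst.comp Primrec.fst).pair (Primrec.fst.comp Primrec.snd)))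
        (ihh.subst (f := fun q : (ℕ × ℕ) × (ℕ × ℕ) => (q.1.1, q.2.2))
          ((Primrec.fst.comp Primrec.fst).pair (Primrec.snd.comp Primrec.snd))))
        (.eq_prim (Primrec₂.natPair.comp (Primrec.fst.comp Primrec.snd)
          (Primrec.snd.comp Primrec.snd)) (Primrec.snd.comp Primrec.fst)))
    refine this.of_iff fun p => ?_
    simp only [Seq.seq, Part.map_eq_map, Part.mem_bind_iff, Part.mem_map_iff]
    constructor
    · rintro ⟨_, ⟨a, ha, rfl⟩, b, hb, e⟩
      exact ⟨(a, b), ⟨ha, hb⟩, e⟩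
    · rintro ⟨⟨a, b⟩, ⟨ha, hb⟩, e⟩
      exact ⟨_, ⟨a, ha, rfl⟩, b, hb, e⟩
  | @comp f h _ _ ihf ihh =>
    have := IsSigmaIn.ex (Z := Z) (p := fun q : (ℕ × ℕ) × ℕ => q.2 ∈ h q.1.1 ∧ q.1.2 ∈ f q.2) (.and
      (ihh.subst (f := fun q : (ℕ × ℕ) × ℕ => (q.1.1, q.2))
        ((Primrec.fst.comp Primrec.fst).pair Primrec.snd))
      (ihf.subst (f := fun q : (ℕ × ℕ) × ℕ => (q.2, q.1.2))
        (Primrec.snd.pair (Primrec.snd.comp Primrec.fst))))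
    exact this.of_iff fun p => Part.mem_bind_iff
  | @prec f h _ _ ihf ihh =>
    -- Primitive recursion is expressed by a list of intermediate values: `h1` checks its start,
    -- `h2` and `h3` its transitions, `h4` its last relevant entry.
    have h1 : IsSigmaIn Z fun q : (ℕ × ℕ) × List ℕ =>
        ∃ v, q.2[0]? = some v ∧ v ∈ f q.1.1.unpair.1 := by
      refine .ex (p := fun q : ((ℕ × ℕ) × List ℕ) × ℕ =>
        q.1.2[0]? = some q.2 ∧ q.2 ∈ f q.1.1.1.unpair.1) (.and (.eq_prim ?_ ?_) ?_)
      · exact Primrec.list_getElem?.comp (Primrec.snd.comp Primrec.fst) (Primrec.const 0)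
      · exact Primrec.option_some.comp Primrec.snd
      · exact ihf.subst (f := fun q : ((ℕ × ℕ) × List ℕ) × ℕ => (q.1.1.1.unpair.1, q.2))
          ((unp1.comp (Primrec.fst.comp (Primrec.fst.comp Primrec.fst))).pair Primrec.snd)
    have h2 : IsSigmaIn Z fun q : ((ℕ × ℕ) × List ℕ) × ℕ => ∃ u v,
        (q.1.2[q.2]? = some u ∧ q.1.2[q.2 + 1]? = some v) ∧
          v ∈ h (Nat.pair q.1.1.1.unpair.1 (Nat.pair q.2 u)) := by
      refine .ex (p := fun q : (((ℕ × ℕ) × List ℕ) × ℕ) × ℕ => ∃ v,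
        (q.1.1.2[q.1.2]? = some q.2 ∧ q.1.1.2[q.1.2 + 1]? = some v) ∧
          v ∈ h (Nat.pair q.1.1.1.1.unpair.1 (Nat.pair q.1.2 q.2))) ?_
      refine .ex (p := fun q : ((((ℕ × ℕ) × List ℕ) × ℕ) × ℕ) × ℕ =>
        (q.1.1.1.2[q.1.1.2]? = some q.1.2 ∧ q.1.1.1.2[q.1.1.2 + 1]? = some q.2) ∧
          q.2 ∈ h (Nat.pair q.1.1.1.1.1.unpair.1 (Nat.pair q.1.1.2 q.1.2)))
        (.and (.and (.eq_prim ?_ ?_) (.eq_prim ?_ ?_)) ?_)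
      · exact Primrec.list_getElem?.comp
          (Primrec.snd.comp (Primrec.fst.comp (Primrec.fst.comp Primrec.fst)))
          (Primrec.snd.comp (Primrec.fst.comp Primrec.fst))
      · exact Primrec.option_some.comp (Primrec.snd.comp Primrec.fst)
      · exact Primrec.list_getElem?.comp
          (Primrec.snd.comp (Primrec.fst.comp (Primrec.fst.comp Primrec.fst)))
          (Primrec.succ.comp (Primrec.snd.comp (Primrec.fst.comp Primrec.fst)))
      · exact Primrec.option_some.comp Primrec.snd
      · exact ihh.subst (f := fun q : ((((ℕ × ℕ) × List ℕ) × ℕ) × ℕ) × ℕ =>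
          (Nat.pair q.1.1.1.1.1.unpair.1 (Nat.pair q.1.1.2 q.1.2), q.2))
          ((Primrec₂.natPair.comp (unp1.comp (Primrec.fst.comp (Primrec.fst.comp
            (Primrec.fst.comp (Primrec.fst.comp Primrec.fst)))))
            (Primrec₂.natPair.comp (Primrec.snd.comp (Primrec.fst.comp Primrec.fst))
              (Primrec.snd.comp Primrec.fst))).pair Primrec.snd)
    have h3 := h2.all (l := fun q : (ℕ × ℕ) × List ℕ => List.range q.1.1.unpair.2)
      (Primrec.list_range.comp (unp2.comp (Primrec.fst.comp Primrec.fst)))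
    have h4 : IsSigmaIn Z fun q : (ℕ × ℕ) × List ℕ => q.2[q.1.1.unpair.2]? = some q.1.2 :=
      .eq_prim (Primrec.list_getElem?.comp Primrec.snd
        (unp2.comp (Primrec.fst.comp Primrec.fst)))
        (Primrec.option_some.comp (Primrec.snd.comp Primrec.fst))
    refine (h1.and (h3.and h4)).ex.of_iff fun p => ?_
    exact mem_rec_iff_exists_list (f p.1.unpair.1)
      (fun i u => h (Nat.pair p.1.unpair.1 (Nat.pair i u))) p.1.unpair.2 p.2
  | @rfind f _ ihf =>
    have h1 : IsSigmaIn Z fun q : (ℕ × ℕ) × ℕ => ∃ v, v ∈ f (Nat.pair q.1.1 q.2) ∧ v ≠ 0 := by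
      refine .ex (p := fun q : ((ℕ × ℕ) × ℕ) × ℕ => q.2 ∈ f (Nat.pair q.1.1.1 q.1.2) ∧ q.2 ≠ 0)
        (.and ?_ (.prim ?_))
      · exact ihf.subst (f := fun q : ((ℕ × ℕ) × ℕ) × ℕ => (Nat.pair q.1.1.1 q.1.2, q.2))
          ((Primrec₂.natPair.comp (Primrec.fst.comp (Primrec.fst.comp Primrec.fst))
            (Primrec.snd.comp Primrec.fst)).pair Primrec.snd)
      · exact (Primrec.eq.comp Primrec.snd (Primrec.const 0)).not
    have h2 := h1.all (l := fun q : ℕ × ℕ => List.range q.2)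
      (Primrec.list_range.comp Primrec.snd)
    have h3 := ihf.subst (f := fun q : ℕ × ℕ => (Nat.pair q.1 q.2, 0))
      ((Primrec₂.natPair.comp Primrec.fst Primrec.snd).pair (Primrec.const 0))
    refine (h3.and h2).of_iff fun p => ?_
    refine Nat.mem_rfind.trans ?_
    simp

/-- The set `A` is computable relative to `Z`. -/
def IsDeltaIn (Z : ℕ → ℕ) (A : Set ℕ) : Prop :=
  IsSigmaIn Z (· ∈ A) ∧ IsSigmaIn Z (· ∉ A)

lemma mem_charFun {A : Set ℕ} {n y : ℕ} :
    y ∈ charFun A n ↔ (n ∈ A ∧ y = 1) ∨ (n ∉ A ∧ y = 0) := by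
  by_cases h : n ∈ A <;> simp [charFun, h]

namespace IsDeltaIn

variable {Z : ℕ → ℕ} {A B C : Set ℕ}

lemma charFun (h : IsDeltaIn Z A) : IsSigmaIn Z fun p : ℕ × ℕ => p.2 ∈ charFun A p.1 :=
  (((h.1.subst Primrec.fst).and (.eq_prim Primrec.snd (Primrec.const 1))).or
    ((h.2.subst Primrec.fst).and (.eq_prim Primrec.snd (Primrec.const 0)))).of_iff
      fun _ => mem_charFun

lemma isSigmaIn (h : IsDeltaIn Z A) (hC : IsSigma01In A C) : IsSigmaIn Z (· ∈ C) := by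
  refine (IsSigmaIn.ex (isSigmaIn_of_recursiveIn h.charFun hC)).of_iff fun n => ?_
  simp

lemma of_turingLE (h : IsDeltaIn Z A) (hB : SetTuringLE B A) : IsDeltaIn Z B := by
  have hB' := isSigmaIn_of_recursiveIn h.charFun (RecursiveIn.iff_nat.1 hB)
  constructor
  · exact (hB'.subst (f := fun n : ℕ => (n, 1)) (Primrec.id.pair (Primrec.const 1))).of_iff
      fun n => by simp [mem_charFun]
  · exact (hB'.subst (f := fun n : ℕ => (n, 0)) (Primrec.id.pair (Primrec.const 0))).of_iff
      fun n => by simp [mem_charFun]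

lemma joinSeq {Γ : Type} [Primcodable Γ] {z : ℕ → Γ} (h : IsDeltaIn Z A) :
    IsDeltaIn (joinSeq Z z) A :=
  ⟨h.1.joinSeq, h.2.joinSeq⟩

lemma setJoin (hA : IsDeltaIn Z A) (hB : IsDeltaIn Z B) : IsDeltaIn Z (setJoin A B) := by
  have e : ∀ m, m ∈ _root_.setJoin A B ↔
      (m % 2 = 0 ∧ m / 2 ∈ A) ∨ (m % 2 = 1 ∧ m / 2 ∈ B) := by
    intro m
    simp only [_root_.setJoin, Set.mem_ofPred_eq]
    constructor
    · rintro (⟨n, hn, rfl⟩ | ⟨n, hn, rfl⟩)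
      · left; simpa using hn
      · right
        refine ⟨by omega, ?_⟩
        rwa [show (2 * n + 1) / 2 = n by omega]
    · rintro (⟨h, hn⟩ | ⟨h, hn⟩)
      · exact .inl ⟨_, hn, by omega⟩
      · exact .inr ⟨_, hn, by omega⟩
  have half : Primrec fun m : ℕ => m / 2 := Primrec.nat_div.comp Primrec.id (Primrec.const 2)
  have par : ∀ i, IsSigmaIn Z fun m : ℕ => m % 2 = i := fun i =>
    .eq_prim (Primrec.nat_mod.comp Primrec.id (Primrec.const 2)) (Primrec.const i)
  constructor
  · exact (((par 0).and (hA.1.subst half)).or ((par 1).and (hB.1.subst half))).of_iff e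
  · refine (((par 0).and (hA.2.subst half)).or ((par 1).and (hB.2.subst half))).of_iff fun m => ?_
    rw [e]
    rcases Nat.mod_two_eq_zero_or_one m with h | h <;> simp [h]

end IsDeltaIn

/-! ### Cross-trees as conditions. -/

/-- The point of the product space with the given sequence of values. -/
def toCrossPoint {r : ℕ} (z : ℕ → Fin 3 × (Fin r → Fin 2)) : CrossPoint r :=
  (fun n => (z n).1, fun s n => (z n).2 s)

/-- The pair of strings with the given list of values. -/
def toCrossString {r : ℕ} (L : List (Fin 3 × (Fin r → Fin 2))) : CrossString r :=
  (L.map Prod.fst, fun s => L.map fun c => c.2 s)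

lemma primrec_toCrossString {r : ℕ} :
    Primrec (toCrossString : List (Fin 3 × (Fin r → Fin 2)) → CrossString r) := by
  refine Primrec.pair (Primrec.list_map Primrec.id (Primrec.fst.comp Primrec.snd).to₂) ?_
  rw [Primrec.fin_curry]
  exact Primrec.list_map Primrec.fst (Primrec.fin_app.comp (Primrec.snd.comp Primrec.snd)
    (Primrec.snd.comp Primrec.fst)).to₂

lemma restrict_toCrossPoint {r : ℕ} (z : ℕ → Fin 3 × (Fin r → Fin 2)) (n : ℕ) :
    (toCrossPoint z).restrict n = toCrossString (firstValues z n) := by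
  simp [CrossPoint.restrict, toCrossPoint, toCrossString, initSeg, firstValues, Function.comp_def]

/-- A search finds the value of `z` at the first coordinate; comparing its code with the second
coordinate settles membership either way. -/
lemma isDeltaIn_toSet {r : ℕ} {Z : ℕ → ℕ} {z : ℕ → Fin 3 × (Fin r → Fin 2)}
    (h : IsSigmaIn Z fun p : ℕ × (Fin 3 × (Fin r → Fin 2)) => z p.1 = p.2) :
    IsDeltaIn Z (toCrossPoint z).toSet := by
  have e : ∀ m, m ∈ (toCrossPoint z).toSet ↔ natCode (z m.unpair.1) = m.unpair.2 := by
    intro m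
    constructor
    · rintro ⟨n, rfl⟩
      simp [toCrossPoint]
    · intro hm
      refine ⟨m.unpair.1, ?_⟩
      change m = Nat.pair m.unpair.1 (natCode (z m.unpair.1))
      rw [hm, Nat.pair_unpair]
  have h' := h.subst (f := fun q : ℕ × (Fin 3 × (Fin r → Fin 2)) => (q.1.unpair.1, q.2))
    ((Primrec.fst.comp (Primrec.unpair.comp Primrec.fst)).pair Primrec.snd)
  have hE : PrimrecPred fun q : ℕ × (Fin 3 × (Fin r → Fin 2)) =>
      natCode q.2 = q.1.unpair.2 :=
    Primrec.eq.comp (Primrec.encode.comp Primrec.snd)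
      (Primrec.snd.comp (Primrec.unpair.comp Primrec.fst))
  constructor
  · exact (h'.and (.prim hE)).ex.of_iff fun m => by simp [e]
  · exact (h'.and (.prim hE.not)).ex.of_iff fun m => by simp [e]

/-- An instance whose complement is `Σ⁰₁` relative to `Z`, as a condition. -/
lemma exists_condition {r : ℕ} {Z : ℕ → ℕ} {T : Set (CrossString r)} (hT : IsCCInstance T)
    (hZ : IsSigmaIn Z (· ∉ T)) :
    ∃ p : FreeCondition r Z, ∀ z ∈ p.points, toCrossPoint z ∈ paths T := by
  have h1 : IsSigmaRel Z fun (L : List (Fin 3 × (Fin r → Fin 2)))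
      (z : ℕ → Fin 3 × (Fin r → Fin 2)) =>
      ∀ i ∈ List.range L.length, ∃ c, z i = c ∧ L[i]? = some c := by
    refine IsSigmaOn.all (P := fun (q : List (Fin 3 × (Fin r → Fin 2)) × ℕ)
      (w : ℕ → ℕ × (Fin 3 × (Fin r → Fin 2))) => ∃ c, (Prod.snd ∘ w) q.2 = c ∧ q.1[q.2]? = some c)
      ?_ (Primrec.list_range.comp Primrec.list_length)
    refine IsSigmaRel.ex (P := fun (q : (List (Fin 3 × (Fin r → Fin 2)) × ℕ) ×
      (Fin 3 × (Fin r → Fin 2))) (z : ℕ → Fin 3 × (Fin r → Fin 2)) =>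
      z q.1.2 = q.2 ∧ q.1.1[q.1.2]? = some q.2) (.and ?_ (.prim ?_))
    · exact IsSigmaRel.oracle.subst (f := fun q : (List (Fin 3 × (Fin r → Fin 2)) × ℕ) ×
        (Fin 3 × (Fin r → Fin 2)) => (q.1.2, q.2))
        ((Primrec.snd.comp Primrec.fst).pair Primrec.snd)
    · exact Primrec.eq.comp (Primrec.list_getElem?.comp (Primrec.fst.comp Primrec.fst)
        (Primrec.snd.comp Primrec.fst)) (Primrec.option_some.comp Primrec.snd)
  have h2 := (IsSigmaRel.of_isSigmaIn (Γ := Fin 3 × (Fin r → Fin 2)) hZ).subst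
    primrec_toCrossString
  -- A point leaves `[T]` by having an initial segment outside `T`, so enumerating the complement of
  -- `T` is enough.
  have h3 : IsClosedIn Z {z | toCrossPoint z ∈ paths T} := by
    refine (IsSigmaRel.ex (P := fun (q : Unit × List (Fin 3 × (Fin r → Fin 2))) z =>
      toCrossString q.2 ∉ T ∧ ∀ i ∈ List.range q.2.length, ∃ c, z i = c ∧ q.2[i]? = some c)
      ((h2.and h1).subst Primrec.snd)).of_iff fun _ z => ?_
    have e : ∀ L : List (Fin 3 × (Fin r → Fin 2)),
        (∀ i ∈ List.range L.length, ∃ c, z i = c ∧ L[i]? = some c) ↔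
          L = firstValues z L.length := by
      intro L
      rw [eq_firstValues_iff]
      simp
    simp only [e, paths, Set.mem_ofPred_eq, not_forall, restrict_toCrossPoint]
    constructor
    · rintro ⟨n, hn⟩
      exact ⟨_, hn, by simp⟩
    · rintro ⟨L, hL, h⟩
      exact ⟨L.length, h ▸ hL⟩
  -- With the empty stem, fullness of the condition is exactly left-fullness of `T`.
  refine ⟨⟨fun _ => 0, 0, _, fun _ _ => trivial, h3, fun X _ => ?_⟩, fun z hz => hz.1⟩
  obtain ⟨Y, hY⟩ := hT.2 X
  exact ⟨fun n s => Y s n, hY⟩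

lemma isCCSolution_of_points {r : ℕ} {T : Set (CrossString r)}
    {z z' : ℕ → Fin 3 × (Fin r → Fin 2)} (hz : toCrossPoint z ∈ paths T)
    (hz' : toCrossPoint z' ∈ paths T) (hne : ∃ l, ∀ i ≥ l, (z' i).1 ≠ (z i).1)
    (heq : ∀ s n, ∃ m ≥ n, (z' m).2 s = (z m).2 s) :
    IsCCSolution T (toCrossPoint z) (toCrossPoint z') := by
  refine ⟨hz, hz', fun i => ?_, fun s hfin => ?_⟩
  · obtain ⟨l, hl⟩ := hne
    refine (Set.finite_lt_nat l).subset fun n hn => ?_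
    by_contra hnl
    have h1 : (z n).1 = i := hn.1
    have h2 : (z' n).1 = i := hn.2
    exact hl n (not_lt.1 hnl) (h2.trans h1.symm)
  -- The places of agreement are the union of finitely many sets, one per colour.
  · have hU : {n | (z' n).2 s = (z n).2 s}.Finite := by
      refine (Set.finite_iUnion hfin).subset fun n hn => ?_
      exact Set.mem_iUnion.2 ⟨(z n).2 s, rfl, hn⟩
    obtain ⟨b, hb⟩ := hU.bddAbove
    obtain ⟨m, hm, h⟩ := heq s (b + 1)
    have := hb h
    omega

/-- The relativized form of the theorem on solutions that do not enumerate `C`. -/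
theorem exists_isCCSolution {r : ℕ} {Z : ℕ → ℕ} {C : Set ℕ} (hC : ¬ IsSigmaIn Z (· ∈ C))
    {T : Set (CrossString r)} (hT : IsCCInstance T) (hZ : IsSigmaIn Z (· ∉ T)) :
    ∃ (Z' : ℕ → ℕ) (z₀ z₁ : CrossPoint r), ¬ IsSigmaIn Z' (· ∈ C) ∧
      (∀ A, IsDeltaIn Z A → IsDeltaIn Z' A) ∧ IsCCSolution T z₀ z₁ ∧
      IsDeltaIn Z' (setJoin z₀.toSet z₁.toSet) := by
  obtain ⟨p, hp⟩ := exists_condition hT hZ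
  obtain ⟨z, hz, z', hz', hne, heq, hzC⟩ := FreeCondition.exists_solution hC p
  refine ⟨joinSeq (joinSeq Z z) z', _, _, hzC, fun A hA => hA.joinSeq.joinSeq,
    isCCSolution_of_points (hp z hz) (hp z' hz') hne heq, ?_⟩
  exact (isDeltaIn_toSet isSigmaIn_joinSeq_self.joinSeq).setJoin
    (isDeltaIn_toSet isSigmaIn_joinSeq_self)

/-- Initial segments of the zero oracle are computable, so an unbounded search enumerates `C`. -/
lemma isSigma01_of_isSigmaIn_zero {C : Set ℕ} (h : IsSigmaIn (fun _ => 0) (· ∈ C)) :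
    IsSigma01 C := by
  classical
  obtain ⟨R, hR, -, hC⟩ := h
  have hp : PrimrecRel fun n k : ℕ => R (n, firstValues (fun _ => 0) k) :=
    hR.comp (Primrec.fst.pair (Primrec.list_map (Primrec.list_range.comp Primrec.snd)
      (Primrec.const 0).to₂))
  have h1 : Partrec fun n : ℕ => Nat.rfind fun k =>
      Part.some (decide (R (n, firstValues (fun _ => 0) k))) :=
    Partrec.rfind hp.decide.to_comp.partrec₂
  refine (Partrec.dom_re h1).of_eq fun n => ?_
  refine Iff.trans (Nat.rfind_dom.trans ?_) (hC n _ rfl).symm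
  simp

/-! ### Iteration to an ideal, and the theorem. -/

/-- A sequence of oracles not enumerating `C` that computes solutions to all the instances
computable from one of its terms. -/
lemma exists_oracle_sequence (r : ℕ) {C : Set ℕ} (hC : ¬ IsSigmaIn (fun _ => 0) (· ∈ C)) :
    ∃ Z : ℕ → ℕ → ℕ, (∀ n, ¬ IsSigmaIn (Z n) (· ∈ C)) ∧
      (∀ m n, m ≤ n → ∀ A, IsDeltaIn (Z m) A → IsDeltaIn (Z n) A) ∧
      ∀ n, ∀ T : Set (CrossString r), IsCCInstance T → IsDeltaIn (Z n) (natCode '' T) →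
        ∃ n' z₀ z₁, IsCCSolution T z₀ z₁ ∧ IsDeltaIn (Z n') (setJoin z₀.toSet z₁.toSet) := by
  classical
  have compl : ∀ (Z : ℕ → ℕ) (T : Set (CrossString r)), IsDeltaIn Z (natCode '' T) →
      IsSigmaIn Z (· ∉ T) := by
    intro Z T h
    refine (h.2.subst (f := (natCode : CrossString r → ℕ)) Primrec.encode).of_iff fun χ => ?_
    have inj : Function.Injective (natCode : CrossString r → ℕ) :=
      fun _ _ h => @Encodable.encode_injective _ Primcodable.toEncodable _ _ h
    rw [inj.mem_set_image]
  have enum : ∀ Z : ℕ → ℕ, ∃ e : ℕ → Set (CrossString r), ∀ T, IsSigmaIn Z (· ∉ T) →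
      ∃ j, e j = T := by
    intro Z
    have hcount : {T : Set (CrossString r) | IsSigmaIn Z (· ∉ T)}.Countable := by
      have : {T : Set (CrossString r) | IsSigmaIn Z (· ∉ T)} ⊆ Set.range
          fun R : {R : CrossString r × List ℕ → Prop // PrimrecPred R} =>
            {χ | ¬ ∃ k, R.1 (χ, firstValues Z k)} := by
        rintro T ⟨R, hR, -, h⟩
        refine ⟨⟨R, hR⟩, ?_⟩
        ext χ
        rw [Set.mem_ofPred_eq, ← h χ Z rfl, not_not]
      exact (Set.countable_range _).mono this
    obtain ⟨e, he⟩ := hcount.exists_eq_range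
      ⟨Set.univ, (IsSigmaIn.prim (α := CrossString r) ((Primrec.eq.comp (Primrec.const 0)
        (Primrec.const 1)))).of_iff (fun _ => by simp)⟩
    exact ⟨e, fun T hT => by
      have : T ∈ Set.range e := he ▸ hT
      exact this⟩
  choose e he using enum
  have step : ∀ (Z : {Z : ℕ → ℕ // ¬ IsSigmaIn Z (· ∈ C)}) (T : Set (CrossString r)),
      ∃ Z' : {Z : ℕ → ℕ // ¬ IsSigmaIn Z (· ∈ C)},
        (∀ A, IsDeltaIn Z.1 A → IsDeltaIn Z'.1 A) ∧
        (IsCCInstance T → IsDeltaIn Z.1 (natCode '' T) → ∃ z₀ z₁, IsCCSolution T z₀ z₁ ∧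
          IsDeltaIn Z'.1 (setJoin z₀.toSet z₁.toSet)) := by
    intro Z T
    by_cases h : IsCCInstance T ∧ IsDeltaIn Z.1 (natCode '' T)
    · obtain ⟨Z', z₀, z₁, h1, h2, h3, h4⟩ := exists_isCCSolution Z.2 h.1 (compl _ _ h.2)
      exact ⟨⟨Z', h1⟩, h2, fun _ _ => ⟨z₀, z₁, h3, h4⟩⟩
    · exact ⟨Z, fun _ h => h, fun h1 h2 => absurd ⟨h1, h2⟩ h⟩
  choose next hle hsol using step
  -- Stage `n` treats the tree with index `n.unpair.2` in the list of the oracle `n.unpair.1`, which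
  -- is at most `n`. Carrying the whole history makes that earlier oracle available.
  let hist : ℕ → ℕ → {Z : ℕ → ℕ // ¬ IsSigmaIn Z (· ∈ C)} := fun n => n.rec (fun _ => ⟨_, hC⟩)
    fun n h => Function.update h (n + 1) (next (h n) (e (h n.unpair.1).1 n.unpair.2))
  have hist_succ : ∀ n, hist (n + 1) = Function.update (hist n) (n + 1)
      (next (hist n n) (e (hist n n.unpair.1).1 n.unpair.2)) := fun _ => rfl
  have hist_eq : ∀ n, ∀ i ≤ n, hist n i = hist i i := by
    intro n
    induction n with
    | zero => intro i hi; rw [Nat.le_zero.1 hi]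
    | succ n ih =>
      intro i hi
      rcases Nat.le_succ_iff.1 hi with hi | rfl
      · rw [hist_succ, Function.update_of_ne (by omega), ih i hi]
      · rfl
  have hZ : ∀ n, hist (n + 1) (n + 1) =
      next (hist n n) (e (hist n.unpair.1 n.unpair.1).1 n.unpair.2) := by
    intro n
    rw [hist_succ, Function.update_self, hist_eq n _ (Nat.unpair_left_le n)]
  have hmono : ∀ m n, m ≤ n → ∀ A, IsDeltaIn (hist m m).1 A → IsDeltaIn (hist n n).1 A := by
    intro m n hmn
    induction n, hmn using Nat.le_induction with
    | base => exact fun _ h => h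
    | succ n _ ih => exact fun A hA => by rw [hZ]; exact hle _ _ A (ih A hA)
  refine ⟨fun n => (hist n n).1, fun n => (hist n n).2, hmono, fun n T hT hn => ?_⟩
  obtain ⟨j, hj⟩ := he (hist n n).1 T (compl _ _ hn)
  -- The tree is treated only at stage `Nat.pair n j ≥ n`, where it is still computable from the
  -- current oracle.
  have hnj := hmono n (Nat.pair n j) (Nat.left_le_pair n j) _ hn
  refine ⟨Nat.pair n j + 1, ?_⟩
  obtain ⟨z₀, z₁, h1, h2⟩ := hsol (hist (Nat.pair n j) (Nat.pair n j)) T hT hnj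
  refine ⟨z₀, z₁, h1, ?_⟩
  change IsDeltaIn (hist (Nat.pair n j + 1) (Nat.pair n j + 1)).1 _
  rw [hZ, Nat.unpair_pair]
  simpa only [hj] using h2

theorem mainTheorem7 (r : ℕ) :
    (∀ C : Set ℕ, ¬ IsSigma01 C →
      ∀ T : Set (CrossString r), IsCCInstance T → IsComputableSet T →
        ∃ z₀ z₁ : CrossPoint r, IsCCSolution T z₀ z₁ ∧
          ¬ IsSigma01In (setJoin z₀.toSet z₁.toSet) C) ∧
    (∀ C : Set ℕ, ¬ IsSigma01 C →
      ∃ M : Set (Set ℕ), IsCrossConstraintIdeal r M ∧ ∀ Z ∈ M, ¬ IsSigma01In Z C) ∧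
    (∀ C : Set ℕ, ¬ IsComputableSet C →
      ∀ T : Set (CrossString r), IsCCInstance T → IsComputableSet T →
        ∃ z₀ z₁ : CrossPoint r, IsCCSolution T z₀ z₁ ∧
          ¬ SetTuringLE C (setJoin z₀.toSet z₁.toSet)) := by
  have compl : ∀ T : Set (CrossString r), IsComputableSet T →
      IsSigmaIn (fun _ => 0) (· ∉ T) := fun T hT =>
    IsSigmaOn.of_re (ComputablePred.computable_iff_re_compl_re'.1 hT).2
  refine ⟨fun C hC T hT hTc => ?_, fun C hC => ?_, fun C hC T hT hTc => ?_⟩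
  · obtain ⟨Z, z₀, z₁, h1, -, h3, h4⟩ :=
      exists_isCCSolution (fun h => hC (isSigma01_of_isSigmaIn_zero h)) hT (compl T hTc)
    exact ⟨z₀, z₁, h3, fun h => h1 (h4.isSigmaIn h)⟩
  · obtain ⟨Z, h1, h2, h3⟩ :=
      exists_oracle_sequence r (C := C) fun h => hC (isSigma01_of_isSigmaIn_zero h)
    refine ⟨{A | ∃ n, IsDeltaIn (Z n) A}, ⟨⟨?_, ?_, ?_⟩, ?_⟩, ?_⟩
    · have hf : PrimrecPred fun _ : ℕ => False :=
        (Primrec.eq.comp (Primrec.const 0) (Primrec.const 1)).of_eq fun _ => by simp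
      have ht : PrimrecPred fun _ : ℕ => True := hf.not.of_eq fun _ => by simp
      exact ⟨∅, 0, (IsSigmaIn.prim hf).of_iff fun _ => by simp,
        (IsSigmaIn.prim ht).of_iff fun _ => by simp⟩
    · rintro A ⟨n, hA⟩ B hB
      exact ⟨n, hA.of_turingLE hB⟩
    · rintro A ⟨m, hA⟩ B ⟨n, hB⟩
      exact ⟨max m n, (h2 _ _ (le_max_left _ _) A hA).setJoin (h2 _ _ (le_max_right _ _) B hB)⟩
    · rintro T hT ⟨n, hn⟩
      obtain ⟨n', z₀, z₁, h4, h5⟩ := h3 n T hT hn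
      exact ⟨z₀, z₁, h4, n', h5⟩
    · rintro A ⟨n, hA⟩ hAC
      exact h1 n (hA.isSigmaIn hAC)
  -- By Post's theorem one of `C`, `Cᶜ` is not `Σ⁰₁`; computing `C` from the solution would
  -- enumerate both.
  · have hC' : ¬ IsSigma01 C ∨ ¬ IsSigma01 Cᶜ := by
      by_contra hc
      push Not at hc
      exact hC (ComputablePred.computable_iff_re_compl_re'.2 hc)
    rcases hC' with hC' | hC'
    · obtain ⟨Z, z₀, z₁, h1, -, h3, h4⟩ :=
        exists_isCCSolution (fun h => hC' (isSigma01_of_isSigmaIn_zero h)) hT (compl T hTc)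
      exact ⟨z₀, z₁, h3, fun h => h1 (h4.of_turingLE h).1⟩
    · obtain ⟨Z, z₀, z₁, h1, -, h3, h4⟩ :=
        exists_isCCSolution (fun h => hC' (isSigma01_of_isSigmaIn_zero h)) hT (compl T hTc)
      exact ⟨z₀, z₁, h3, fun h => h1 (h4.of_turingLE h).2⟩
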